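/- Consider the following dynamic matching market. Agents of two types, $H$ and $E$, arrive according to independent Poisson processes with rates $\lambda_H>0$ and $\lambda_E>0$. Any agent of type $H$ (respectively $E$) finds the item of any given other agent compatible with probability $p_H\in(0,1]$ (respectively $p_E\in(0,1]$), independently over all ordered pairs of agents. Under the policy BilateralMatch($H$), when a new agent arrives and there are waiting agents with whom she is mutually compatible, she is matched immediately with one of them, chosen uniformly at random among those of type $H$ if there are any, and uniformly at random among those of type $E$ otherwise; the two matched agents leave the market. If there is no such waiting agent, the new agent stays and waits. The numbers $(h,e)$ of waiting agents of types $H$ and $E$ form a continuous-time Markov chain on $\mathbb{N}^2$. Fix $\lambda_E>0$ and $p_E\in(0,1]$. For all $\lambda_H\in(0,\lambda_E)$ and $p_H\in(0,1]$ this chain has a unique stationary distribution, and the average waiting time $w_H(\lambda_H,p_H)$ in steady state of agents of type $H$ (the expected value of departure time minus arrival time) is finite. For every $\lambda_H\in(0,\lambda_E)$ the limiting (rescaled) average waiting time $$L(\lambda_H)=\lim_{p_H\to 0^+} p_H\, w_H(\lambda_H,p_H)$$ exists and is finite, and $\lambda_H\mapsto L(\lambda_H)$ is strictly increasing on the interval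 $(0,\lambda_E)$. -/

import Mathlib

open Set Filter Topology
open scoped ENNReal

namespace DynMarket

/-- The two types of agents: hard-to-match (`H`) and easy-to-match (`E`). -/
inductive AgentType
  | H
  | E
  deriving DecidableEq

instance : Fintype AgentType where
  elems := {AgentType.H, AgentType.E}
  complete := by intro T; cases T <;> simp

/-- The numerical data of a market: Poisson arrival rates of the two types, and the probabilities
with which an agent of each type finds the item of any given other agent compatible. -/
structure Market where
  lamH : ℝ
  lamE : ℝ
  pH : ℝ
  pE : ℝ

noncomputable section

/-- Arrival rate of agents of type `T`. -/
def Market.rate (m : Market) : AgentType → ℝ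
  | .H => m.lamH
  | .E => m.lamE

/-- Probability that an agent of type `T` finds the item of any given other agent compatible. -/
def Market.prob (m : Market) : AgentType → ℝ
  | .H => m.pH
  | .E => m.pE

/-- Rate of the superposition of the two independent Poisson arrival processes. -/
def Market.totalRate (m : Market) : ℝ := ∑ T : AgentType, m.rate T

/-- State of the marketplace: `(h, e)` means that `h` agents of type `H` and `e` agents of type `E`
are waiting. -/
abbrev State := ℕ × ℕ

/-- The agents waiting in state `s`. -/
abbrev Waiting (s : State) := Fin s.1 ⊕ Fin s.2

/-- The type of a waiting agent. -/
def typeOf {s : State} (i : Waiting s) : AgentType :=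
  Sum.elim (fun _ => AgentType.H) (fun _ => AgentType.E) i

/-- One more agent of type `T` is waiting. -/
def addAgent : AgentType → State → State
  | .H, s => (s.1 + 1, s.2)
  | .E, s => (s.1, s.2 + 1)

/-- One agent of type `T` has left. It is only used when such an agent is present. -/
def removeAgent : AgentType → State → State
  | .H, s => (s.1 - 1, s.2)
  | .E, s => (s.1, s.2 - 1)

/-- The edges of the compatibility graph between a newly arrived agent and the waiting agents:
`(ω i).1` says that the newcomer finds the item of `i` compatible (edge from `i` to the newcomer),
`(ω i).2` that `i` finds the item of the newcomer compatible (edge from the newcomer to `i`). -/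
abbrev Edges (s : State) := Waiting s → Bool × Bool

/-- Probability that a Bernoulli variable of parameter `p` takes the value `b`. -/
def bern (p : ℝ) (b : Bool) : ℝ := if b then p else 1 - p

/-- Probability that the edges between a newcomer of type `T` and the waiting agents are `ω`:
all directed edges are formed independently, each with the probability given by the type of the
agent at its head. -/
def edgeProb (m : Market) (T : AgentType) {s : State} (ω : Edges s) : ℝ :=
  ∏ i : Waiting s, bern (m.prob T) (ω i).1 * bern (m.prob (typeOf i)) (ω i).2

/-- The waiting agents that form a cycle of length two with the newcomer. -/
def cyclePartners {s : State} (ω : Edges s) : Finset (Waiting s) :=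
  Finset.univ.filter fun i => ω i = (true, true)

/-- The policy BilateralMatch(`P`): the waiting agents among which the partner of the newcomer is
drawn uniformly at random. These are the cycle partners of type `P` if there are any, and all cycle
partners otherwise; if this set is empty, no exchange takes place. -/
def candidates (P : AgentType) {s : State} (ω : Edges s) : Finset (Waiting s) :=
  if ((cyclePartners ω).filter fun i => typeOf i = P).Nonempty then
    (cyclePartners ω).filter fun i => typeOf i = P
  else cyclePartners ω

/-- Probability that a newcomer of type `T` arriving in state `s` is matched at once with the
waiting agent `i`. -/
def partnerProb (m : Market) (P T : AgentType) (s : State) (i : Waiting s) : ℝ :=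
  ∑ ω : Edges s, edgeProb m T ω *
    (if i ∈ candidates P ω then 1 / ((candidates P ω).card : ℝ) else 0)

/-- Probability that a newcomer of type `T` arriving in state `s` is not matched at once. -/
def stayProb (m : Market) (P T : AgentType) (s : State) : ℝ :=
  ∑ ω : Edges s, edgeProb m T ω * (if candidates P ω = ∅ then 1 else 0)

/-- Probability that an arrival of type `T` changes the state from `s` to `s'`. -/
def arrivalTransition (m : Market) (P T : AgentType) (s s' : State) : ℝ :=
  (if s' = addAgent T s then stayProb m P T s else 0) +
    ∑ i : Waiting s, if s' = removeAgent (typeOf i) s then partnerProb m P T s i else 0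

/-- Transition rates of the continuous-time Markov chain of the numbers of waiting agents under
BilateralMatch(`P`). (Every arrival changes the state, so `Q s s = 0` here; the diagonal of the
generator plays no role below.) -/
def transitionRate (m : Market) (P : AgentType) (s s' : State) : ℝ :=
  ∑ T : AgentType, m.rate T * arrivalTransition m P T s s'

/-- `π` is a steady-state (stationary) distribution of the Markov chain under BilateralMatch(`P`):
it satisfies the global balance equations, flow into `s` equals flow out of `s` for every state. -/
def IsSteadyState (m : Market) (P : AgentType) (π : PMF State) : Prop :=
  ∀ s : State, ∑' s' : State, π s' * ENNReal.ofReal (transitionRate m P s' s) =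
    π s * ∑' s' : State, ENNReal.ofReal (transitionRate m P s s')

/-- A particular agent of type `H` that is waiting together with the agents counted by `o`. Agents
of the same type are exchangeable, so the choice of the label does not matter. -/
def tagged (o : State) : Waiting (addAgent .H o) := Sum.inl (0 : Fin (o.1 + 1))

/-- Probability that a waiting agent of type `H`, in a market where the *other* waiting agents are
counted by `o`, has not been matched by any of the next `n` arrivals. Each arrival is of type `T`
with probability `rate T / totalRate`; the agent keeps waiting if the newcomer stays
unmatched, or is matched with another waiting agent. -/
def stillWaiting (m : Market) (P : AgentType) : ℕ → State → ℝ
  | 0, _ => 1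
  | n + 1, o => ∑ T : AgentType, m.rate T / m.totalRate *
      (stayProb m P T (addAgent .H o) * stillWaiting m P n (addAgent T o) +
        ∑ i ∈ Finset.univ.erase (tagged o),
          partnerProb m P T (addAgent .H o) i * stillWaiting m P n (removeAgent (typeOf i) o))

/-- Probability that the waiting `H` agent of `stillWaiting` is still in the market `t` time units
later: the number of arrivals during that time is Poisson with mean `totalRate * t`. -/
def waitingTail (m : Market) (P : AgentType) (o : State) (t : ℝ) : ℝ≥0∞ :=
  ∑' n : ℕ, ENNReal.ofReal
    (Real.exp (-(m.totalRate * t)) * (m.totalRate * t) ^ n / (n.factorial : ℝ) *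
      stillWaiting m P n o)

/-- Expected remaining time until departure of the waiting `H` agent of `stillWaiting`, as the
integral of the tail of its distribution. -/
def expectedWait (m : Market) (P : AgentType) (o : State) : ℝ≥0∞ :=
  ∫⁻ t in Ioi (0 : ℝ), waitingTail m P o t

/-- Average waiting time (departure time minus arrival time) of agents of type `H` under
BilateralMatch(`P`) when the market is in the steady state `π`: an arriving `H` agent finds the
market in state `s` with probability `π s`; she waits for a time `0` if she is matched upon arrival,
and otherwise joins the agents counted by `s`. -/
def averageWaitH (m : Market) (P : AgentType) (π : PMF State) : ℝ≥0∞ :=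
  ∑' s : State, π s * (ENNReal.ofReal (stayProb m P .H s) * expectedWait m P s)

end

end DynMarket

/-! By Little's law (`rate_mul_averageWaitH`) the mean wait of `H` agents is E[h] / lamH, so
everything rests on E[h] in steady state. For small pH, `H` agents are matched almost only by
arriving `E` agents, each of whom finds a partner among h waiting `H` agents with probability 1 - (1
- pE pH)^h. These matches balance the arrivals of `H` agents when (1 - pE pH)^h = ρ := 1 - lamH /
lamE, that is at h = c := `load / decay`, which is of order 1 / pH; h should concentrate there.

The Lyapunov function (h - c)² + K e² proves this. By `drift` it decreases at rate
`lyapunovDecrease`, up to the error `lyapunovBound`, which does not depend on pH. Hence the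
stationary mean of (h - c)(ρ - (1 - pE pH)^h) is bounded uniformly in pH. Passing to y = decay * h
multiplies this quantity by decay, which tends to 0, and it controls |y - load|
(`exists_abs_sub_le`). So decay * E[h] tends to load, and decay ~ pE pH gives the limit -log(1 -
lamH / lamE) / (pE lamH). Up to a positive factor this is minus a secant slope of log at 1, hence
strictly increasing.

The same function yields existence of a steady state, as a limit of time averages, and finiteness of
E[h]. Uniqueness holds because the empty market can be reached from every state. If pE = pH = 1 the
logarithm degenerates, and (h + e)² serves instead. -/

namespace DynMarket

variable {m : Market}

/-- Probability that a newcomer of type `T` and a given waiting agent of type `S` are not mutually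
compatible. -/
noncomputable def Market.miss (m : Market) (T S : AgentType) : ℝ := 1 - m.prob T * m.prob S

/-! ### Matching probabilities of a single arrival -/

lemma bern_nonneg {p : ℝ} (h0 : 0 ≤ p) (h1 : p ≤ 1) (b : Bool) : 0 ≤ bern p b := by
  unfold bern; split_ifs <;> linarith

/-- Edges to different agents are independent and the event constrains each agent separately, so the
sum of products is a product of sums. -/
lemma sum_edgeProb_avoid (m : Market) (T : AgentType) (s : State) (A : Waiting s → Prop)
    [DecidablePred A] :
    ∑ ω : Edges s, edgeProb m T ω * (if ∀ i, A i → ω i ≠ (true, true) then 1 else 0) =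
      ∏ i : Waiting s, if A i then m.miss T (typeOf i) else 1 := by
  have key : ∀ i : Waiting s, (if A i then m.miss T (typeOf i) else 1) =
      ∑ b : Bool × Bool, bern (m.prob T) b.1 * bern (m.prob (typeOf i)) b.2 *
        (if A i → b ≠ (true, true) then 1 else 0) := by
    intro i
    rw [Fintype.sum_prod_type]
    by_cases h : A i <;> simp [h, bern, Market.miss] <;> ring
  rw [Finset.prod_congr rfl fun i _ => key i, Finset.prod_univ_sum, Fintype.piFinset_univ]
  refine Finset.sum_congr rfl fun ω _ => ?_
  rw [Finset.prod_mul_distrib, edgeProb]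
  congr 1
  split_ifs with h
  · exact (Finset.prod_eq_one fun i _ => if_pos (h i)).symm
  · push Not at h
    obtain ⟨i, hi, hω⟩ := h
    exact (Finset.prod_eq_zero (Finset.mem_univ i) (by simp [hi, hω])).symm

lemma sum_edgeProb (m : Market) (T : AgentType) (s : State) :
    ∑ ω : Edges s, edgeProb m T ω = 1 := by
  simpa using sum_edgeProb_avoid m T s (fun _ => False)

lemma mem_candidates (P : AgentType) {s : State} (ω : Edges s) (j : Waiting s) :
    j ∈ candidates P ω ↔ ω j = (true, true) ∧
      (typeOf j = P ∨ ∀ k, typeOf k = P → ω k ≠ (true, true)) := by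
  unfold candidates
  split_ifs with h
  · simp only [cyclePartners, Finset.mem_filter, Finset.mem_univ, true_and]
    obtain ⟨k, hk⟩ := h
    simp only [cyclePartners, Finset.mem_filter, Finset.mem_univ, true_and] at hk
    exact and_congr_right fun _ => ⟨Or.inl, fun h => h.resolve_right fun h' => h' k hk.2 hk.1⟩
  · simp only [cyclePartners, Finset.mem_filter, Finset.mem_univ, true_and]
    refine ⟨fun hj => ⟨hj, Or.inr fun k hk hω => h ⟨k, ?_⟩⟩, And.left⟩
    simp [cyclePartners, hk, hω]

lemma candidates_eq_empty_iff (P : AgentType) {s : State} (ω : Edges s) :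
    candidates P ω = ∅ ↔ ∀ i, ω i ≠ (true, true) := by
  unfold candidates
  split_ifs with h
  · constructor
    · intro h'; simp [h'] at h
    · obtain ⟨i, hi⟩ := h
      intro h'
      simp [cyclePartners] at hi
      exact absurd hi.1 (h' i)
  · simp [cyclePartners, Finset.filter_eq_empty_iff]

lemma stayProb_eq (m : Market) (P T : AgentType) (s : State) :
    stayProb m P T s = m.miss T .H ^ s.1 * m.miss T .E ^ s.2 := by
  have := sum_edgeProb_avoid m T s (fun _ => True)
  simp only [forall_true_left, if_true] at this
  rw [stayProb]
  simp only [candidates_eq_empty_iff]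
  rw [this, Fintype.prod_sum_type]
  simp [typeOf]

lemma sum_candidates_eq {P : AgentType} {s : State} (ω : Edges s) :
    ∑ i : Waiting s, (if i ∈ candidates P ω then 1 / ((candidates P ω).card : ℝ) else 0) =
      1 - if candidates P ω = ∅ then 1 else 0 := by
  rw [Finset.sum_ite_mem, Finset.univ_inter, Finset.sum_const, nsmul_eq_mul]
  split_ifs with h
  · simp [h]
  · have : ((candidates P ω).card : ℝ) ≠ 0 := by simpa using h
    field_simp
    simp

/-- Once some `H` agent is compatible, all candidates are of type `H`, and their uniform weights add
up to 1. -/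
lemma sum_preferred_candidates_eq {s : State} (ω : Edges s) :
    ∑ j : Fin s.1, (if (Sum.inl j : Waiting s) ∈ candidates .H ω
        then 1 / ((candidates .H ω).card : ℝ) else 0) =
      1 - if ∀ i : Waiting s, typeOf i = .H → ω i ≠ (true, true) then 1 else 0 := by
  by_cases hH : ∀ i : Waiting s, typeOf i = .H → ω i ≠ (true, true)
  · rw [if_pos hH, sub_self]
    exact Finset.sum_eq_zero fun j _ => if_neg fun h =>
      hH _ rfl ((mem_candidates .H ω _).1 h).1
  · have h1 := sum_candidates_eq (P := .H) ω
    have hne : candidates .H ω ≠ ∅ := by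
      rw [ne_eq, candidates_eq_empty_iff]
      exact fun h => hH fun i _ => h i
    have hr : ∀ j : Fin s.2, (Sum.inr j : Waiting s) ∉ candidates .H ω := by
      intro j h
      exact (((mem_candidates .H ω _).1 h).2.resolve_left (by simp [typeOf])) |> hH
    rw [Fintype.sum_sum_type] at h1
    simp only [hr, if_false, Finset.sum_const_zero, add_zero, hne] at h1
    rw [h1, if_neg hH]

lemma sum_partnerProb_inl (m : Market) (T : AgentType) (s : State) :
    ∑ j : Fin s.1, partnerProb m .H T s (Sum.inl j) = 1 - m.miss T .H ^ s.1 := by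
  have h1 := sum_edgeProb_avoid m T s (fun i => typeOf i = .H)
  rw [Fintype.prod_sum_type] at h1
  simp [typeOf] at h1
  simp only [partnerProb]
  rw [Finset.sum_comm]
  simp_rw [← Finset.mul_sum, sum_preferred_candidates_eq, mul_sub, mul_one]
  rw [Finset.sum_sub_distrib, sum_edgeProb]
  simp [typeOf, h1]

lemma sum_partnerProb_inr (m : Market) (T : AgentType) (s : State) :
    ∑ j : Fin s.2, partnerProb m .H T s (Sum.inr j) =
      m.miss T .H ^ s.1 * (1 - m.miss T .E ^ s.2) := by
  have h : ∑ i : Waiting s, partnerProb m .H T s i = 1 - stayProb m .H T s := by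
    simp only [partnerProb]
    rw [Finset.sum_comm]
    simp_rw [← Finset.mul_sum, sum_candidates_eq, mul_sub, mul_one]
    rw [Finset.sum_sub_distrib, sum_edgeProb, stayProb]
  rw [Fintype.sum_sum_type, sum_partnerProb_inl, stayProb_eq] at h
  linear_combination h

/-- Exchangeability: relabelling agents within their types preserves both the law of the edges and
the policy. -/
lemma partnerProb_comp_perm (m : Market) (P T : AgentType) (s : State)
    (σ : Equiv.Perm (Waiting s)) (hσ : ∀ i, typeOf (σ i) = typeOf i) (i : Waiting s) :
    partnerProb m P T s (σ i) = partnerProb m P T s i := by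
  have hmem : ∀ (ω : Edges s) (j : Waiting s),
      j ∈ candidates P (ω ∘ σ) ↔ σ j ∈ candidates P ω := by
    intro ω j
    rw [mem_candidates, mem_candidates, ← σ.forall_congr_right (q := fun k =>
      typeOf k = P → ω k ≠ (true, true))]
    simp only [hσ, Function.comp]
  have hcard : ∀ ω : Edges s, (candidates P (ω ∘ σ)).card = (candidates P ω).card := by
    intro ω
    refine Finset.card_bij (fun j _ => σ j) (fun j hj => (hmem ω j).1 hj)
      (fun _ _ _ _ h => σ.injective h) fun j hj => ⟨σ.symm j, (hmem ω _).2 (by simpa), by simp⟩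
  unfold partnerProb
  refine Fintype.sum_equiv (σ.symm.arrowCongr (Equiv.refl _)) _ _ fun ω => ?_
  have hω : (σ.symm.arrowCongr (Equiv.refl _)) ω = ω ∘ σ := rfl
  rw [hω]
  congr 1
  · unfold edgeProb
    refine (Fintype.prod_equiv σ _ _ fun j => ?_).symm
    simp [hσ]
  · simp only [hmem, hcard]

lemma card_mul_partnerProb_inl (m : Market) (T : AgentType) (s : State) (j : Fin s.1) :
    s.1 * partnerProb m .H T s (Sum.inl j) = 1 - m.miss T .H ^ s.1 := by
  rw [← sum_partnerProb_inl]
  have : ∀ k : Fin s.1, partnerProb m .H T s (Sum.inl k) = partnerProb m .H T s (Sum.inl j) := by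
    intro k
    have := partnerProb_comp_perm m .H T s ((Equiv.swap j k).sumCongr (Equiv.refl _))
      (by rintro (i | i) <;> rfl) (Sum.inl j)
    simpa using this
  simp [this]

lemma edgeProb_nonneg (hp : ∀ T, m.prob T ∈ Icc (0 : ℝ) 1) (T : AgentType) {s : State}
    (ω : Edges s) : 0 ≤ edgeProb m T ω :=
  Finset.prod_nonneg fun _ _ =>
    mul_nonneg (bern_nonneg (hp _).1 (hp _).2 _) (bern_nonneg (hp _).1 (hp _).2 _)

lemma partnerProb_nonneg (hp : ∀ T, m.prob T ∈ Icc (0 : ℝ) 1) (P T : AgentType) (s : State)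
    (i : Waiting s) : 0 ≤ partnerProb m P T s i :=
  Finset.sum_nonneg fun _ _ => mul_nonneg (edgeProb_nonneg hp _ _) (by split_ifs <;> positivity)

lemma stayProb_nonneg (hp : ∀ T, m.prob T ∈ Icc (0 : ℝ) 1) (P T : AgentType) (s : State) :
    0 ≤ stayProb m P T s :=
  Finset.sum_nonneg fun _ _ => mul_nonneg (edgeProb_nonneg hp _ _) (by split_ifs <;> positivity)

lemma miss_nonneg (hp : ∀ T, m.prob T ∈ Icc (0 : ℝ) 1) (T S : AgentType) : 0 ≤ m.miss T S :=
  sub_nonneg.2 (mul_le_one₀ (hp T).2 (hp S).1 (hp S).2)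

lemma miss_le_one (hp : ∀ T, m.prob T ∈ Icc (0 : ℝ) 1) (T S : AgentType) : m.miss T S ≤ 1 :=
  sub_le_self _ (mul_nonneg (hp T).1 (hp S).1)

/-! ### The generator and stationary expectations -/

/-- Markets with positive arrival rates and positive compatibility probabilities. -/
structure Market.Regular (m : Market) : Prop where
  rate_pos : ∀ T, 0 < m.rate T
  prob_pos : ∀ T, 0 < m.prob T
  prob_le_one : ∀ T, m.prob T ≤ 1

lemma Market.Regular.prob_mem (hm : m.Regular) (T : AgentType) : m.prob T ∈ Icc (0 : ℝ) 1 :=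
  ⟨(hm.prob_pos T).le, hm.prob_le_one T⟩

lemma sum_agentType {M : Type*} [AddCommMonoid M] (f : AgentType → M) :
    ∑ T, f T = f .H + f .E := by
  rw [show (Finset.univ : Finset AgentType) = {.H, .E} from rfl, Finset.sum_pair (by simp)]

lemma Market.Regular.totalRate_pos (hm : m.Regular) : 0 < m.totalRate := by
  rw [Market.totalRate, sum_agentType]
  exact add_pos (hm.rate_pos _) (hm.rate_pos _)

lemma Market.Regular.miss_lt_one (hm : m.Regular) (T S : AgentType) : m.miss T S < 1 :=
  sub_lt_self _ (mul_pos (hm.prob_pos T) (hm.prob_pos S))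

/-- The chain under BilateralMatch(`H`) acting on functions: `m.gen F s` is the rate-weighted sum
of the values of `F` over the states reached from `s` by one arrival. -/
noncomputable def Market.gen (m : Market) : (State → ℝ) →ₗ[ℝ] (State → ℝ) where
  toFun F s := ∑ T, m.rate T *
    (m.miss T .H ^ s.1 * m.miss T .E ^ s.2 * F (addAgent T s) +
      ((1 - m.miss T .H ^ s.1) * F (removeAgent .H s) +
        m.miss T .H ^ s.1 * (1 - m.miss T .E ^ s.2) * F (removeAgent .E s)))
  map_add' F G := by ext s; simp only [sum_agentType, Pi.add_apply]; ring
  map_smul' c F := by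
    ext s; simp only [sum_agentType, Pi.smul_apply, smul_eq_mul, RingHom.id_apply]; ring

lemma Market.gen_apply (m : Market) (F : State → ℝ) (s : State) :
    m.gen F s = ∑ T, m.rate T *
    (m.miss T .H ^ s.1 * m.miss T .E ^ s.2 * F (addAgent T s) +
      ((1 - m.miss T .H ^ s.1) * F (removeAgent .H s) +
        m.miss T .H ^ s.1 * (1 - m.miss T .E ^ s.2) * F (removeAgent .E s))) := rfl

lemma Market.gen_const (m : Market) (c : ℝ) (s : State) :
    m.gen (fun _ => c) s = m.totalRate * c := by
  simp only [Market.gen_apply, Market.totalRate, sum_agentType]; ring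

lemma Market.Regular.gen_mono (hm : m.Regular) {F G : State → ℝ} (h : ∀ s, F s ≤ G s)
    (s : State) : m.gen F s ≤ m.gen G s := by
  simp only [Market.gen_apply]
  refine Finset.sum_le_sum fun T _ => mul_le_mul_of_nonneg_left ?_ (hm.rate_pos T).le
  have h1 := pow_nonneg (miss_nonneg hm.prob_mem T .H) s.1
  have h2 := pow_nonneg (miss_nonneg hm.prob_mem T .E) s.2
  have h3 := pow_le_one₀ (n := s.1) (miss_nonneg hm.prob_mem T .H) (miss_le_one hm.prob_mem T .H)
  have h4 := pow_le_one₀ (n := s.2) (miss_nonneg hm.prob_mem T .E) (miss_le_one hm.prob_mem T .E)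
  refine add_le_add (mul_le_mul_of_nonneg_left (h _) (by positivity))
    (add_le_add (mul_le_mul_of_nonneg_left (h _) (by linarith))
      (mul_le_mul_of_nonneg_left (h _) (mul_nonneg h1 (by linarith))))

lemma Market.Regular.gen_nonneg (hm : m.Regular) {F : State → ℝ} (h : ∀ s, 0 ≤ F s)
    (s : State) : 0 ≤ m.gen F s := by
  simpa using (m.gen_const 0 s).symm.le.trans (hm.gen_mono h s)

lemma sum_transition_mul (m : Market) (F : State → ℝ) (s : State) :
    ∑ T, m.rate T * (stayProb m .H T s * F (addAgent T s) +
      ∑ i : Waiting s, partnerProb m .H T s i * F (removeAgent (typeOf i) s)) = m.gen F s := by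
  rw [Market.gen_apply]
  refine Finset.sum_congr rfl fun T _ => ?_
  rw [stayProb_eq, Fintype.sum_sum_type, ← sum_partnerProb_inl, ← sum_partnerProb_inr,
    Finset.sum_mul, Finset.sum_mul]
  rfl

/-- Links the rates of the model to `gen`; F = 1 gives the total exit rate, and the indicator of a
state gives a single rate. -/
lemma Market.Regular.tsum_transitionRate_mul (hm : m.Regular) {F : State → ℝ}
    (hF : ∀ s, 0 ≤ F s) (s : State) :
    ∑' s', ENNReal.ofReal (transitionRate m .H s s') * ENNReal.ofReal (F s') =
      ENNReal.ofReal (m.gen F s) := by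
  have hst := fun T => stayProb_nonneg hm.prob_mem .H T s
  have hpa := fun T => partnerProb_nonneg hm.prob_mem .H T s
  have hr := fun T => (hm.rate_pos T).le
  have e1 : ∀ s', ENNReal.ofReal (transitionRate m .H s s') * ENNReal.ofReal (F s') =
      ∑ T, ENNReal.ofReal (m.rate T) *
        ((if s' = addAgent T s then ENNReal.ofReal (stayProb m .H T s) * ENNReal.ofReal (F s')
          else 0) + ∑ i : Waiting s, if s' = removeAgent (typeOf i) s then
            ENNReal.ofReal (partnerProb m .H T s i) * ENNReal.ofReal (F s') else 0) := by
    intro s'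
    have h1 : ∀ T, 0 ≤ if s' = addAgent T s then stayProb m .H T s else 0 := fun T => by
      split_ifs; exacts [hst T, le_rfl]
    have h2 : ∀ T i, 0 ≤ if s' = removeAgent (typeOf i) s then partnerProb m .H T s i else 0 :=
      fun T i => by split_ifs; exacts [hpa T i, le_rfl]
    have h3 : ∀ T, 0 ≤ ∑ i, if s' = removeAgent (typeOf i) s then partnerProb m .H T s i else 0 :=
      fun T => Finset.sum_nonneg fun i _ => h2 T i
    simp only [transitionRate, arrivalTransition]
    rw [ENNReal.ofReal_sum_of_nonneg fun T _ =>
      mul_nonneg (hr T) (add_nonneg (h1 T) (h3 T)), Finset.sum_mul]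
    refine Finset.sum_congr rfl fun T _ => ?_
    rw [ENNReal.ofReal_mul (hr T), ENNReal.ofReal_add (h1 T) (h3 T),
      ENNReal.ofReal_sum_of_nonneg fun i _ => h2 T i, mul_assoc, add_mul, Finset.sum_mul]
    congr 2
    · split_ifs <;> simp
    · refine Finset.sum_congr rfl fun i _ => ?_
      split_ifs <;> simp
  simp_rw [e1]
  rw [Summable.tsum_finsetSum fun _ _ => ENNReal.summable]
  simp_rw [ENNReal.tsum_mul_left, ENNReal.tsum_add]
  simp_rw [Summable.tsum_finsetSum fun _ _ => ENNReal.summable, tsum_ite_eq]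
  rw [← sum_transition_mul, ENNReal.ofReal_sum_of_nonneg fun T _ => mul_nonneg (hr T)
    (add_nonneg (mul_nonneg (hst T) (hF _)) (Finset.sum_nonneg fun i _ =>
      mul_nonneg (hpa T i) (hF _)))]
  refine Finset.sum_congr rfl fun T _ => ?_
  rw [ENNReal.ofReal_mul (hr T), ENNReal.ofReal_add (mul_nonneg (hst T) (hF _))
    (Finset.sum_nonneg fun i _ => mul_nonneg (hpa T i) (hF _)),
    ENNReal.ofReal_sum_of_nonneg fun i _ => mul_nonneg (hpa T i) (hF _)]
  simp_rw [ENNReal.ofReal_mul (hst T), ENNReal.ofReal_mul (hpa T _)]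

lemma Market.Regular.tsum_transitionRate (hm : m.Regular) (s : State) :
    ∑' s', ENNReal.ofReal (transitionRate m .H s s') = ENNReal.ofReal m.totalRate := by
  have := hm.tsum_transitionRate_mul (F := fun _ => 1) (fun _ => zero_le_one) s
  simpa [m.gen_const] using this

lemma Market.Regular.ofReal_transitionRate (hm : m.Regular) (s s' : State) :
    ENNReal.ofReal (transitionRate m .H s s') = ENNReal.ofReal (m.gen (Pi.single s' 1) s) := by
  rw [← hm.tsum_transitionRate_mul (F := Pi.single s' 1) (fun x => ?_), tsum_eq_single s']
  · simp
  · intro x hx; simp [hx]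
  · by_cases hx : x = s'
    · subst hx; simp
    · simp [hx]

lemma Market.Regular.isSteadyState_iff (hm : m.Regular) (π : PMF State) :
    IsSteadyState m .H π ↔ ∀ s, ∑' s', π s' * ENNReal.ofReal (transitionRate m .H s' s) =
      π s * ENNReal.ofReal m.totalRate := by
  simp only [IsSteadyState, hm.tsum_transitionRate]

/-- Balance tested against F; working in `ℝ≥0∞`, Tonelli applies without integrability of F. -/
lemma Market.Regular.tsum_mul_gen (hm : m.Regular) {π : PMF State} (hπ : IsSteadyState m .H π)
    {F : State → ℝ} (hF : ∀ s, 0 ≤ F s) :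
    ∑' s, π s * ENNReal.ofReal (m.gen F s) =
      ENNReal.ofReal m.totalRate * ∑' s, π s * ENNReal.ofReal (F s) := by
  simp_rw [← hm.tsum_transitionRate_mul hF, ← ENNReal.tsum_mul_left]
  rw [ENNReal.tsum_comm]
  refine tsum_congr fun s' => ?_
  simp_rw [← mul_assoc]
  rw [ENNReal.tsum_mul_right, (hm.isSteadyState_iff π).1 hπ, mul_comm (π s')]

/-- Foster–Lyapunov bound for stationary expectations. -/
lemma Market.Regular.tsum_le_of_drift (hm : m.Regular) {π : PMF State}
    (hπ : IsSteadyState m .H π) {F g : State → ℝ} {c : ℝ} (hF : ∀ s, 0 ≤ F s)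
    (hg : ∀ s, 0 ≤ g s) (hc : 0 ≤ c) (h : ∀ s, m.gen F s + g s ≤ m.totalRate * F s + c) :
    ∑' s, π s * ENNReal.ofReal (g s) ≤ ENNReal.ofReal c := by
  classical
  have hΛ := hm.totalRate_pos.le
  have hn : ∀ n : ℕ, ∑' s, π s * ENNReal.ofReal (if F s ≤ n then g s else 0) ≤
      ENNReal.ofReal c := by
    intro n
    -- F may have infinite mean, so the balance terms could not be cancelled. Its truncation at n is
    -- bounded and still satisfies the drift inequality with g cut off to F ≤ n.
    set G : State → ℝ := fun s => min (F s) n with hG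
    have hG0 : ∀ s, 0 ≤ G s := fun s => le_min (hF s) n.cast_nonneg
    have hpt : ∀ s, m.gen G s + (if F s ≤ n then g s else 0) ≤ m.totalRate * G s + c := by
      intro s
      split_ifs with hs
      · have h1 : m.gen G s ≤ m.gen F s := hm.gen_mono (fun _ => min_le_left _ _) s
        have h2 : G s = F s := min_eq_left hs
        rw [h2]; linarith [h s]
      · have h1 : m.gen G s ≤ m.gen (fun _ => (n : ℝ)) s :=
          hm.gen_mono (fun _ => min_le_right _ _) s
        have h2 : G s = n := min_eq_right (not_le.1 hs).le
        rw [m.gen_const] at h1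
        rw [h2]; linarith
    have hsum := hm.tsum_mul_gen hπ hG0
    have hfin : ENNReal.ofReal m.totalRate * ∑' s, π s * ENNReal.ofReal (G s) ≠ ⊤ := by
      refine ENNReal.mul_ne_top ENNReal.ofReal_ne_top (ne_top_of_le_ne_top
        (b := ∑' s, π s * ENNReal.ofReal n) ?_ (ENNReal.tsum_le_tsum fun s => ?_))
      · rw [ENNReal.tsum_mul_right, π.tsum_coe, one_mul]; exact ENNReal.ofReal_ne_top
      · gcongr; exact min_le_right _ _
    refine (ENNReal.add_le_add_iff_left hfin).1 ?_
    calc _ = ∑' s, π s * ENNReal.ofReal (m.gen G s + (if F s ≤ n then g s else 0)) := by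
            rw [← hsum, ← ENNReal.tsum_add]
            refine tsum_congr fun s => ?_
            rw [ENNReal.ofReal_add (hm.gen_nonneg hG0 s) (by split_ifs; exacts [hg s, le_rfl]),
              mul_add]
      _ ≤ ∑' s, π s * ENNReal.ofReal (m.totalRate * G s + c) := by
            exact ENNReal.tsum_le_tsum fun s => by gcongr π s * ENNReal.ofReal ?_; exact hpt s
      _ = _ := by
            simp_rw [ENNReal.ofReal_add (mul_nonneg hΛ (hG0 _)) hc, ENNReal.ofReal_mul hΛ, mul_add]
            rw [ENNReal.tsum_add, ENNReal.tsum_mul_right, π.tsum_coe, one_mul,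
              ← ENNReal.tsum_mul_left]
            simp_rw [mul_left_comm]
  refine ENNReal.summable.tsum_le_of_sum_le fun A => ?_
  obtain ⟨n, hn'⟩ := exists_nat_ge (∑ s ∈ A, F s)
  refine le_trans ?_ (hn n)
  refine le_trans (Finset.sum_le_sum fun s hs => ?_) (ENNReal.sum_le_tsum A)
  rw [if_pos ((Finset.single_le_sum (fun s _ => hF s) hs).trans hn')]

/-! ### Uniqueness of the steady state -/

section Uniqueness

variable {S : Type*} {κ : S → S → ℝ≥0∞} {l : ℝ≥0∞}

lemma eq_of_le_of_tsum_eq {f g : S → ℝ≥0∞} (h : ∀ s, f s ≤ g s) (hs : ∑' s, f s = ∑' s, g s)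
    (hf : ∑' s, f s ≠ ⊤) : f = g := by
  by_contra hne
  obtain ⟨s, hs'⟩ := Function.ne_iff.1 hne
  exact (ENNReal.tsum_lt_tsum hf h (lt_of_le_of_ne (h s) hs')).ne hs

/-- The flow out of the minimum is at most the minimum of the two flows; both sides have the same
finite total mass, so equality holds at every state. -/
lemma invariant_min (hrow : ∀ s, ∑' s', κ s s' = l) (hl : l ≠ ⊤) {π₁ π₂ : PMF S}
    (h₁ : ∀ s, ∑' s', π₁ s' * κ s' s = π₁ s * l) (h₂ : ∀ s, ∑' s', π₂ s' * κ s' s = π₂ s * l) :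
    ∀ s, ∑' s', min (π₁ s') (π₂ s') * κ s' s = min (π₁ s) (π₂ s) * l := by
  have key : ∑' s, ∑' s', min (π₁ s') (π₂ s') * κ s' s = ∑' s, min (π₁ s) (π₂ s) * l := by
    rw [ENNReal.tsum_comm]
    simp_rw [ENNReal.tsum_mul_left, hrow]
  refine fun s => congr_fun (eq_of_le_of_tsum_eq (fun s => ?_) key ?_) s
  · rw [min_mul_of_nonneg _ _ (zero_le (a := l)), ← h₁, ← h₂]
    exact le_min (ENNReal.tsum_le_tsum fun _ => by gcongr; exact min_le_left _ _)
      (ENNReal.tsum_le_tsum fun _ => by gcongr; exact min_le_right _ _)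
  · rw [key, ENNReal.tsum_mul_right]
    exact ENNReal.mul_ne_top (ne_top_of_le_ne_top ENNReal.one_ne_top
      (π₁.tsum_coe ▸ ENNReal.tsum_le_tsum fun _ => min_le_left _ _)) hl

/-- If an invariant measure can only vanish at `o` by vanishing identically, then the invariant
probability measure is unique. -/
lemma invariant_unique (hrow : ∀ s, ∑' s', κ s s' = l) (hl : l ≠ ⊤) (o : S)
    (ho : ∀ μ : S → ℝ≥0∞, (∀ s, ∑' s', μ s' * κ s' s = μ s * l) → μ o = 0 → μ = 0)
    {π₁ π₂ : PMF S} (h₁ : ∀ s, ∑' s', π₁ s' * κ s' s = π₁ s * l)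
    (h₂ : ∀ s, ∑' s', π₂ s' * κ s' s = π₂ s * l) : π₁ = π₂ := by
  wlog hle : π₁ o ≤ π₂ o generalizing π₁ π₂
  · exact (this h₂ h₁ (le_of_not_ge hle)).symm
  have hm := invariant_min hrow hl h₁ h₂
  -- The excess of π₁ over the minimum is invariant and vanishes at o.
  have hsub : (fun s => π₁ s - min (π₁ s) (π₂ s)) = 0 := by
    refine ho _ (fun s => ?_) (by simp [hle])
    have hfin : min (π₁ s) (π₂ s) * l ≠ ⊤ :=
      ENNReal.mul_ne_top (ne_top_of_le_ne_top (π₁.apply_ne_top s) (min_le_left _ _)) hl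
    rw [ENNReal.sub_mul fun _ _ => hl]
    refine ENNReal.eq_sub_of_add_eq hfin ?_
    rw [← hm s, ← ENNReal.tsum_add, ← h₁ s]
    refine tsum_congr fun s' => ?_
    rw [← add_mul, tsub_add_cancel_of_le (min_le_left _ _)]
  have hle' : ∀ s, π₁ s ≤ π₂ s := fun s =>
    (tsub_eq_zero_iff_le.1 (congr_fun hsub s)).trans (min_le_right _ _)
  refine DFunLike.coe_injective (eq_of_le_of_tsum_eq hle' ?_ ?_)
  · rw [π₁.tsum_coe, π₂.tsum_coe]
  · rw [π₁.tsum_coe]; exact ENNReal.one_ne_top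

end Uniqueness

lemma single_nonneg' (s s' : State) : (0 : ℝ) ≤ (Pi.single s 1 : State → ℝ) s' := by
  by_cases h : s' = s
  · subst h; simp
  · simp [h]

/-- With `transition_pos_E`, this gives a path from any state to the empty market: the `H` agents
leave first, then the `E` agents. -/
lemma Market.Regular.transition_pos_H (hm : m.Regular) (h e : ℕ) :
    ENNReal.ofReal (transitionRate m .H (h + 1, e) (h, e)) ≠ 0 := by
  rw [hm.ofReal_transitionRate, Market.gen_apply]
  refine (ENNReal.ofReal_pos.2 (Finset.sum_pos (fun T _ => mul_pos (hm.rate_pos T) ?_)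
    ⟨.H, Finset.mem_univ _⟩)).ne'
  have h1 := pow_nonneg (miss_nonneg hm.prob_mem T .H) (h + 1)
  have h2 := pow_nonneg (miss_nonneg hm.prob_mem T .E) e
  have h3 := pow_lt_one₀ (miss_nonneg hm.prob_mem T .H) (hm.miss_lt_one T .H) h.succ_ne_zero
  have h4 := pow_le_one₀ (n := e) (miss_nonneg hm.prob_mem T .E) (miss_le_one hm.prob_mem T .E)
  refine add_pos_of_nonneg_of_pos (mul_nonneg (mul_nonneg h1 h2) (single_nonneg' _ _))
    (add_pos_of_pos_of_nonneg ?_ (mul_nonneg (mul_nonneg h1 (sub_nonneg.2 h4)) (single_nonneg' _ _)))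
  simpa [removeAgent] using h3

lemma Market.Regular.transition_pos_E (hm : m.Regular) (e : ℕ) :
    ENNReal.ofReal (transitionRate m .H (0, e + 1) (0, e)) ≠ 0 := by
  rw [hm.ofReal_transitionRate, Market.gen_apply]
  refine (ENNReal.ofReal_pos.2 (Finset.sum_pos (fun T _ => mul_pos (hm.rate_pos T) ?_)
    ⟨.H, Finset.mem_univ _⟩)).ne'
  have h2 := pow_nonneg (miss_nonneg hm.prob_mem T .E) (e + 1)
  have h3 := pow_lt_one₀ (miss_nonneg hm.prob_mem T .E) (hm.miss_lt_one T .E) e.succ_ne_zero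
  refine add_pos_of_nonneg_of_pos (mul_nonneg (by simpa using h2) (single_nonneg' _ _)) ?_
  simpa [removeAgent] using h3

lemma Market.Regular.steadyState_unique (hm : m.Regular) {π₁ π₂ : PMF State}
    (h₁ : IsSteadyState m .H π₁) (h₂ : IsSteadyState m .H π₂) : π₁ = π₂ := by
  rw [hm.isSteadyState_iff] at h₁ h₂
  refine invariant_unique hm.tsum_transitionRate ENNReal.ofReal_ne_top (0, 0) ?_ h₁ h₂
  intro μ hμ h0
  have hback : ∀ s s', μ s = 0 → ENNReal.ofReal (transitionRate m .H s' s) ≠ 0 → μ s' = 0 := by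
    intro s s' hs hκ
    have := hμ s
    rw [hs, zero_mul, ENNReal.tsum_eq_zero] at this
    exact (mul_eq_zero.1 (this s')).resolve_right hκ
  have hE : ∀ e, μ (0, e) = 0 := by
    intro e
    induction e with
    | zero => exact h0
    | succ e ih => exact hback _ _ ih (hm.transition_pos_E e)
  funext ⟨h, e⟩
  induction h with
  | zero => exact hE e
  | succ h ih => exact hback _ _ ih (hm.transition_pos_H h e)

/-! ### Existence of a steady state by time averages -/

/-- Expectation of `f` under the law of the state after `i` arrivals, averaged over `i ≤ n`, for the
chain started in the empty market. -/
noncomputable def Market.occupation (m : Market) (n : ℕ) : (State → ℝ) →ₗ[ℝ] ℝ :=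
  (n + 1 : ℝ)⁻¹ • ∑ i ∈ Finset.range (n + 1),
    (LinearMap.proj (0, 0)).comp ((m.totalRate⁻¹ • m.gen) ^ i)

lemma Market.occupation_apply (m : Market) (n : ℕ) (f : State → ℝ) :
    m.occupation n f = (n + 1 : ℝ)⁻¹ * ∑ i ∈ Finset.range (n + 1),
      ((m.totalRate⁻¹ • m.gen) ^ i) f (0, 0) := by
  simp [Market.occupation, LinearMap.sum_apply]

lemma Market.Regular.iterate_mono (hm : m.Regular) (i : ℕ) {F G : State → ℝ}
    (h : ∀ s, F s ≤ G s) (s : State) :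
    ((m.totalRate⁻¹ • m.gen) ^ i) F s ≤ ((m.totalRate⁻¹ • m.gen) ^ i) G s := by
  induction i generalizing s with
  | zero => simpa using h s
  | succ i ih =>
    rw [pow_succ', Module.End.mul_apply, Module.End.mul_apply]
    exact mul_le_mul_of_nonneg_left (hm.gen_mono ih s) (inv_nonneg.2 hm.totalRate_pos.le)

lemma Market.Regular.iterate_const (hm : m.Regular) (i : ℕ) (c : ℝ) :
    ((m.totalRate⁻¹ • m.gen) ^ i) (fun _ => c) = fun _ => c := by
  induction i with
  | zero => rfl
  | succ i ih =>
    rw [pow_succ', Module.End.mul_apply, ih]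
    funext s
    have := hm.totalRate_pos.ne'
    simp only [LinearMap.smul_apply, Pi.smul_apply, m.gen_const, smul_eq_mul]
    field_simp

lemma Market.Regular.occupation_mono (hm : m.Regular) (n : ℕ) {F G : State → ℝ}
    (h : ∀ s, F s ≤ G s) : m.occupation n F ≤ m.occupation n G := by
  rw [m.occupation_apply, m.occupation_apply]
  exact mul_le_mul_of_nonneg_left (Finset.sum_le_sum fun i _ => hm.iterate_mono i h _)
    (by positivity)

lemma Market.Regular.occupation_const (hm : m.Regular) (n : ℕ) (c : ℝ) :
    m.occupation n (fun _ => c) = c := by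
  simp only [m.occupation_apply, hm.iterate_const, Finset.sum_const, Finset.card_range,
    nsmul_eq_mul]
  push_cast
  field_simp

/-- Telescoping: time averages are invariant up to a boundary term divided by n + 1. -/
lemma Market.Regular.occupation_gen (hm : m.Regular) (n : ℕ) (f : State → ℝ) :
    m.occupation n (m.gen f) = m.totalRate * (m.occupation n f +
      (n + 1 : ℝ)⁻¹ * (((m.totalRate⁻¹ • m.gen) ^ (n + 1)) f (0, 0) - f (0, 0))) := by
  have hΛ := hm.totalRate_pos.ne'
  have h1 : m.gen f = m.totalRate • (m.totalRate⁻¹ • m.gen) f := by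
    rw [LinearMap.smul_apply, smul_smul, mul_inv_cancel₀ hΛ, one_smul]
  have h2 := Finset.sum_range_sub (fun i => ((m.totalRate⁻¹ • m.gen) ^ i) f (0, 0)) (n + 1)
  have h3 : ∀ i, ((m.totalRate⁻¹ • m.gen) ^ i) ((m.totalRate⁻¹ • m.gen) f) =
      ((m.totalRate⁻¹ • m.gen) ^ (i + 1)) f := fun i => by
    rw [pow_succ, Module.End.mul_apply]
  rw [h1, map_smul, smul_eq_mul, m.occupation_apply, m.occupation_apply]
  simp only [h3]
  rw [Finset.sum_sub_distrib] at h2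
  simp only [pow_zero, Module.End.one_apply] at h2
  rw [← h2]
  ring

/-- Only finitely many states lead into s, so the balance equation at s survives pointwise limits.
-/
lemma Market.gen_single_eq_zero (m : Market) {s s' : State}
    (h : s' ∉ Finset.range (s.1 + 2) ×ˢ Finset.range (s.2 + 2)) :
    m.gen (Pi.single s 1) s' = 0 := by
  obtain ⟨a, b⟩ := s
  obtain ⟨a', b'⟩ := s'
  have h' : a + 2 ≤ a' ∨ b + 2 ≤ b' := by
    simp only [Finset.mem_product, Finset.mem_range] at h; omega
  have hs : ∀ x : State, x ≠ (a, b) → (Pi.single (a, b) 1 : State → ℝ) x = 0 := fun x hx =>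
    Pi.single_eq_of_ne hx _
  rw [Market.gen_apply]
  refine Finset.sum_eq_zero fun T _ => ?_
  rw [hs, hs, hs]
  · ring
  · simp only [removeAgent, ne_eq, Prod.mk.injEq]; omega
  · simp only [removeAgent, ne_eq, Prod.mk.injEq]; omega
  · cases T <;> simp only [addAgent, ne_eq, Prod.mk.injEq] <;> omega

lemma Market.gen_single_eq_sum (m : Market) (s : State) :
    m.gen (Pi.single s 1) = ∑ s' ∈ Finset.range (s.1 + 2) ×ˢ Finset.range (s.2 + 2),
      m.gen (Pi.single s 1) s' • Pi.single s' 1 := by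
  funext x
  rw [Finset.sum_apply]
  by_cases hx : x ∈ Finset.range (s.1 + 2) ×ˢ Finset.range (s.2 + 2)
  · rw [Finset.sum_eq_single_of_mem x hx]
    · simp
    · intro y _ hy; simp [Pi.single_eq_of_ne hy.symm]
  · rw [m.gen_single_eq_zero hx, Finset.sum_eq_zero]
    intro y hy
    have : x ≠ y := fun h => hx (h ▸ hy)
    simp [Pi.single_eq_of_ne this]

lemma Market.occupation_finset (m : Market) (n : ℕ) (A : Finset State) :
    ∑ s ∈ A, m.occupation n (Pi.single s 1) = m.occupation n (fun s => if s ∈ A then 1 else 0) := by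
  rw [← map_sum]
  congr 1
  funext x
  rw [Finset.sum_apply]
  split_ifs with hx
  · rw [Finset.sum_eq_single_of_mem x hx]
    · simp
    · intro y _ hy; simp [Pi.single_eq_of_ne hy.symm]
  · refine Finset.sum_eq_zero fun y hy => Pi.single_eq_of_ne (fun h => hx (by rwa [h])) _

/-- Foster–Lyapunov criterion for the existence of a steady state. -/
lemma Market.Regular.exists_steadyState (hm : m.Regular) {F g : State → ℝ} {c : ℝ}
    (hF : ∀ s, 0 ≤ F s) (hg : ∀ s, 0 ≤ g s) (hfin : ∀ B : ℝ, {s | g s ≤ B}.Finite)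
    (h : ∀ s, m.gen F s + g s ≤ m.totalRate * F s + c) :
    ∃ π : PMF State, IsSteadyState m .H π := by
  have hΛ := hm.totalRate_pos
  set C : ℝ := c + m.totalRate * F (0, 0) with hC
  have hφg : ∀ n, m.occupation n g ≤ C := by
    intro n
    have h1 : m.occupation n (m.gen F + g) ≤
        m.occupation n (m.totalRate • F + fun _ => c) := hm.occupation_mono n h
    rw [map_add, map_add, map_smul, hm.occupation_const, hm.occupation_gen, smul_eq_mul] at h1
    have h2 : (0 : ℝ) ≤ ((m.totalRate⁻¹ • m.gen) ^ (n + 1)) F (0, 0) := by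
      have := hm.iterate_mono (n + 1) hF (0, 0)
      rwa [hm.iterate_const] at this
    have h3 : (n + 1 : ℝ)⁻¹ ≤ 1 := inv_le_one_of_one_le₀ (by linarith [n.cast_nonneg (α := ℝ)])
    have h4 : (0 : ℝ) ≤ (n + 1 : ℝ)⁻¹ := by positivity
    have h5 : - F (0, 0) ≤ (n + 1 : ℝ)⁻¹ *
        (((m.totalRate⁻¹ • m.gen) ^ (n + 1)) F (0, 0) - F (0, 0)) := by
      nlinarith [mul_nonneg h4 h2, hF (0, 0)]
    nlinarith
  -- Markov's inequality: the means of g are bounded by C and its sublevel sets are finite, so no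
  -- mass escapes to infinity.
  have htight : ∀ ε : ℝ, 0 < ε → ∃ A : Finset State, ∀ n,
      1 - ε ≤ ∑ s ∈ A, m.occupation n (Pi.single s 1) := by
    intro ε hε
    set B : ℝ := (|C| + 1) / ε with hB
    have hB0 : 0 < B := by positivity
    refine ⟨(hfin B).toFinset, fun n => ?_⟩
    rw [m.occupation_finset]
    have h1 : m.occupation n (fun _ => 1) ≤ m.occupation n
        ((fun s => if s ∈ (hfin B).toFinset then 1 else 0) + B⁻¹ • g) := by
      refine hm.occupation_mono n fun s => ?_
      simp only [Pi.add_apply, Pi.smul_apply, smul_eq_mul, Finite.mem_toFinset, mem_ofPred_eq]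
      split_ifs with hs
      · have := mul_nonneg (inv_nonneg.2 hB0.le) (hg s); linarith
      · rw [zero_add, inv_mul_eq_div, le_div_iff₀ hB0]; linarith
    rw [hm.occupation_const, map_add, map_smul, smul_eq_mul] at h1
    have h2 : B⁻¹ * m.occupation n g ≤ ε := by
      rw [inv_mul_eq_div, div_le_iff₀ hB0, hB, mul_div_cancel₀ _ hε.ne']
      linarith [hφg n, le_abs_self C]
    linarith
  -- Along a free ultrafilter all states converge at once, replacing a diagonal extraction.
  have hlim : ∀ s, ∃ r ∈ Icc (0 : ℝ) 1,
      Tendsto (fun n => m.occupation n (Pi.single s 1)) (hyperfilter ℕ) (𝓝 r) := by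
    intro s
    refine isCompact_Icc.ultrafilter_le_nhds
      ((hyperfilter ℕ).map fun n => m.occupation n (Pi.single s 1)) ?_
    rw [le_principal_iff]
    refine Filter.mem_map.2 (Filter.Eventually.of_forall fun n => ⟨?_, ?_⟩)
    · have := hm.occupation_mono n (single_nonneg' s)
      rwa [hm.occupation_const] at this
    · have := hm.occupation_mono n (F := Pi.single s 1) (G := fun _ => 1) fun x => by
        by_cases hx : x = s
        · subst hx; simp
        · simp [hx]
      rwa [hm.occupation_const] at this
  choose ρ hρ hρlim using hlim
  have hsumlim : ∀ A : Finset State, Tendsto (fun n => ∑ s ∈ A, m.occupation n (Pi.single s 1))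
      (hyperfilter ℕ) (𝓝 (∑ s ∈ A, ρ s)) := fun A => tendsto_finsetSum _ fun s _ => hρlim s
  have hle : ∀ A : Finset State, ∑ s ∈ A, ρ s ≤ 1 := fun A => by
    refine le_of_tendsto' (hsumlim A) fun n => ?_
    rw [m.occupation_finset]
    have := hm.occupation_mono n (F := fun s => if s ∈ A then 1 else 0) (G := fun _ => 1)
      fun s => by split_ifs <;> norm_num
    rwa [hm.occupation_const] at this
  have hsum : HasSum ρ 1 := by
    refine hasSum_of_isLUB_of_nonneg 1 (fun s => (hρ s).1) ⟨?_, fun b hb => ?_⟩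
    · rintro _ ⟨A, rfl⟩; exact hle A
    · refine le_of_forall_pos_sub_le fun ε hε => ?_
      obtain ⟨A, hA⟩ := htight ε hε
      exact (ge_of_tendsto' (hsumlim A) hA).trans (hb ⟨A, rfl⟩)
  have hsum' : HasSum (fun s => ENNReal.ofReal (ρ s)) 1 := by
    rw [← ENNReal.ofReal_one, ← hsum.tsum_eq,
      ENNReal.ofReal_tsum_of_nonneg (fun s => (hρ s).1) hsum.summable]
    exact ENNReal.summable.hasSum
  refine ⟨⟨_, hsum'⟩, (hm.isSteadyState_iff _).2 fun s => ?_⟩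
  have hbal : ∑ s' ∈ Finset.range (s.1 + 2) ×ˢ Finset.range (s.2 + 2),
      m.gen (Pi.single s 1) s' * ρ s' = m.totalRate * ρ s := by
    refine tendsto_nhds_unique (f := fun n => m.occupation n (m.gen (Pi.single s 1)))
      (l := hyperfilter ℕ) ?_ ?_
    · rw [m.gen_single_eq_sum s]
      simp only [map_sum, map_smul, smul_eq_mul]
      rw [← m.gen_single_eq_sum s]
      exact tendsto_finsetSum _ fun s' _ => (hρlim s').const_mul _
    · simp only [hm.occupation_gen]
      have hz : Tendsto (fun n : ℕ => (n + 1 : ℝ)⁻¹ *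
          (((m.totalRate⁻¹ • m.gen) ^ (n + 1)) (Pi.single s 1) (0, 0) -
            (Pi.single s 1 : State → ℝ) (0, 0))) (hyperfilter ℕ) (𝓝 0) := by
        refine Tendsto.mono_left ?_ (Nat.hyperfilter_le_atTop)
        have h0 : Tendsto (fun n : ℕ => (n + 1 : ℝ)⁻¹) atTop (𝓝 0) := by
          simpa using tendsto_one_div_add_atTop_nhds_zero_nat (𝕜 := ℝ)
        refine h0.zero_mul_isBoundedUnder_le ?_
        refine isBoundedUnder_of ⟨1, fun n => ?_⟩
        have hs1 : ∀ x, (Pi.single s 1 : State → ℝ) x ≤ 1 := fun x => by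
          by_cases hx : x = s
          · subst hx; simp
          · simp [hx]
        have h1 := hm.iterate_mono (n + 1) (single_nonneg' s) (0, 0)
        have h2 := hm.iterate_mono (n + 1) hs1 (0, 0)
        rw [hm.iterate_const] at h1 h2
        have h3 := hs1 (0, 0)
        have h4 := single_nonneg' s (0, 0)
        simp only [Function.comp, Real.norm_eq_abs, abs_le]
        constructor <;> linarith
      have := ((hρlim s).add hz).const_mul m.totalRate
      rwa [add_zero] at this
  change ∑' s', ENNReal.ofReal (ρ s') * ENNReal.ofReal (transitionRate m .H s' s) =
    ENNReal.ofReal (ρ s) * ENNReal.ofReal m.totalRate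
  rw [← ENNReal.ofReal_mul (hρ s).1, mul_comm (ρ s), ← hbal,
    ENNReal.ofReal_sum_of_nonneg fun s' _ =>
      mul_nonneg (hm.gen_nonneg (single_nonneg' s) s') (hρ s').1]
  rw [tsum_eq_sum (s := Finset.range (s.1 + 2) ×ˢ Finset.range (s.2 + 2))]
  · refine Finset.sum_congr rfl fun s' _ => ?_
    rw [hm.ofReal_transitionRate, ENNReal.ofReal_mul (hm.gen_nonneg (single_nonneg' s) s'),
      mul_comm]
  · intro s' hs'
    rw [hm.ofReal_transitionRate, m.gen_single_eq_zero hs']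
    simp

/-! ### The tagged agent and Little's law -/

/-- One arrival, seen from a waiting agent of type `H`, as an operator on functions of the state of
the other waiting agents. -/
noncomputable def Market.taggedStep (m : Market) : (State → ℝ) →ₗ[ℝ] (State → ℝ) where
  toFun F o := ∑ T : AgentType, m.rate T / m.totalRate *
      (stayProb m .H T (addAgent .H o) * F (addAgent T o) +
        ∑ i ∈ Finset.univ.erase (tagged o),
          partnerProb m .H T (addAgent .H o) i * F (removeAgent (typeOf i) o))
  map_add' F G := by
    funext o
    simp only [Pi.add_apply, mul_add, Finset.sum_add_distrib]
    ring
  map_smul' c F := by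
    funext o
    simp only [Pi.smul_apply, smul_eq_mul, RingHom.id_apply, Finset.mul_sum, mul_add]
    simp only [mul_left_comm c]

lemma Market.taggedStep_apply (m : Market) (F : State → ℝ) (o : State) :
    m.taggedStep F o = ∑ T : AgentType, m.rate T / m.totalRate *
      (stayProb m .H T (addAgent .H o) * F (addAgent T o) +
        ∑ i ∈ Finset.univ.erase (tagged o),
          partnerProb m .H T (addAgent .H o) i * F (removeAgent (typeOf i) o)) := rfl

lemma stillWaiting_succ (m : Market) (n : ℕ) :
    stillWaiting m .H (n + 1) = m.taggedStep (stillWaiting m .H n) := rfl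

lemma Market.Regular.taggedStep_mono (hm : m.Regular) {F G : State → ℝ} (h : ∀ s, F s ≤ G s)
    (o : State) : m.taggedStep F o ≤ m.taggedStep G o := by
  have hΛ := hm.totalRate_pos.le
  rw [m.taggedStep_apply, m.taggedStep_apply]
  refine Finset.sum_le_sum fun T _ => mul_le_mul_of_nonneg_left (add_le_add ?_
    (Finset.sum_le_sum fun i _ => ?_)) (div_nonneg (hm.rate_pos T).le hΛ)
  · exact mul_le_mul_of_nonneg_left (h _) (stayProb_nonneg hm.prob_mem _ _ _)
  · exact mul_le_mul_of_nonneg_left (h _) (partnerProb_nonneg hm.prob_mem _ _ _ _)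

/-- By exchangeability the tagged agent has a share 1 / (h + 1) of the matches with `H` agents; the
factor h + 1 clears this denominator and leaves h for the others. -/
lemma succ_mul_sum_erase_tagged (m : Market) (T : AgentType) (F : State → ℝ) (h e : ℕ) :
    (h + 1 : ℝ) * ∑ i ∈ Finset.univ.erase (tagged (h, e)),
        partnerProb m .H T (addAgent .H (h, e)) i * F (removeAgent (typeOf i) (h, e)) =
      h * (1 - m.miss T .H ^ (h + 1)) * F (h - 1, e) +
        (h + 1) * (m.miss T .H ^ (h + 1) * (1 - m.miss T .E ^ e)) * F (h, e - 1) := by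
  have h1 := sum_partnerProb_inl m T (h + 1, e)
  have h2 := sum_partnerProb_inr m T (h + 1, e)
  have h3 := card_mul_partnerProb_inl m T (h + 1, e) (0 : Fin (h + 1))
  have h4 := Finset.sum_erase_eq_sub (Finset.mem_univ (tagged (h, e)))
    (f := fun i => partnerProb m .H T (addAgent .H (h, e)) i * F (removeAgent (typeOf i) (h, e)))
  rw [h4, Fintype.sum_sum_type]
  change (h + 1 : ℝ) * ((∑ j : Fin (h + 1), partnerProb m .H T (h + 1, e) (Sum.inl j) *
    F (h - 1, e) + ∑ j : Fin e, partnerProb m .H T (h + 1, e) (Sum.inr j) * F (h, e - 1)) -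
      partnerProb m .H T (h + 1, e) (Sum.inl 0) * F (h - 1, e)) = _
  rw [← Finset.sum_mul, ← Finset.sum_mul, h1, h2]
  push_cast at h3
  linear_combination (-F (h - 1, e)) * h3

/-- Sum of `F` over the waiting agents of type `H`, where `F` is evaluated at the state of the
agents other than the given one. -/
def sumTagged (F : State → ℝ) (s : State) : ℝ := s.1 * F (s.1 - 1, s.2)

lemma sumTagged_nonneg {F : State → ℝ} (hF : ∀ s, 0 ≤ F s) (s : State) : 0 ≤ sumTagged F s :=
  mul_nonneg s.1.cast_nonneg (hF _)

lemma sumTagged_mono {F G : State → ℝ} (h : ∀ s, F s ≤ G s) (s : State) :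
    sumTagged F s ≤ sumTagged G s :=
  mul_le_mul_of_nonneg_left (h _) s.1.cast_nonneg

/-- After an arrival, the waiting `H` agents are the surviving earlier ones together with the
newcomer, if of type `H` and unmatched. This is Little's law for one arrival. -/
lemma Market.Regular.gen_sumTagged (hm : m.Regular) (F : State → ℝ) (s : State) :
    m.gen (sumTagged F) s =
      m.totalRate * sumTagged (m.taggedStep F) s + m.rate .H * (stayProb m .H .H s * F s) := by
  obtain ⟨h, e⟩ := s
  rw [stayProb_eq]
  cases h with
  | zero => simp [Market.gen_apply, sum_agentType, sumTagged, addAgent, removeAgent]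
  | succ h =>
    have hΛ := hm.totalRate_pos.ne'
    have key : m.totalRate * sumTagged (m.taggedStep F) (h + 1, e) = ∑ T, m.rate T *
        ((h + 1) * (m.miss T .H ^ (h + 1) * m.miss T .E ^ e) * F (addAgent T (h, e)) +
        (h * (1 - m.miss T .H ^ (h + 1)) * F (h - 1, e) +
        (h + 1) * (m.miss T .H ^ (h + 1) * (1 - m.miss T .E ^ e)) * F (h, e - 1))) := by
      have hs : sumTagged (m.taggedStep F) (h + 1, e) = (h + 1) * m.taggedStep F (h, e) := by
        simp [sumTagged]
      rw [hs, m.taggedStep_apply, Finset.mul_sum, Finset.mul_sum]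
      refine Finset.sum_congr rfl fun T _ => ?_
      have hst : stayProb m .H T (addAgent .H (h, e)) =
        m.miss T .H ^ (h + 1) * m.miss T .E ^ e := stayProb_eq m .H T _
      rw [← succ_mul_sum_erase_tagged, hst]
      field_simp
    rw [key, Market.gen_apply]
    simp only [sum_agentType, sumTagged, addAgent, removeAgent, Nat.add_sub_cancel]
    push_cast
    ring

/-- `gen_sumTagged` at F = 1 equates the total departure probability of the `H` agents with the
chance that one of them is matched, which is positive. -/
lemma Market.Regular.taggedStep_one (hm : m.Regular) (o : State) :
    m.taggedStep (fun _ => 1) o < 1 := by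
  have hΛ := hm.totalRate_pos
  have h1 := hm.gen_sumTagged (fun _ => 1) (o.1 + 1, o.2)
  rw [stayProb_eq] at h1
  simp only [Market.gen_apply, sum_agentType, sumTagged, addAgent, removeAgent,
    Nat.add_sub_cancel] at h1
  push_cast at h1
  have h3 : ∀ T, m.miss T .H ^ (o.1 + 1) < 1 := fun T =>
    pow_lt_one₀ (miss_nonneg hm.prob_mem T .H) (hm.miss_lt_one T .H) o.1.succ_ne_zero
  have hH := mul_pos (hm.rate_pos .H) (sub_pos.2 (h3 .H))
  have hE := mul_pos (hm.rate_pos .E) (sub_pos.2 (h3 .E))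
  have ho : (0 : ℝ) < o.1 + 1 := by positivity
  have hΛ' : m.totalRate = m.rate .H + m.rate .E := by rw [Market.totalRate, sum_agentType]
  have h2 : m.totalRate * ((o.1 + 1) * m.taggedStep (fun _ => 1) o) <
      m.totalRate * ((o.1 + 1) * 1) := by
    rw [hΛ'] at h1 ⊢; nlinarith
  exact lt_of_mul_lt_mul_left (lt_of_mul_lt_mul_left h2 hΛ.le) ho.le

lemma Market.Regular.stillWaiting_nonneg (hm : m.Regular) (n : ℕ) (o : State) :
    0 ≤ stillWaiting m .H n o := by
  induction n generalizing o with
  | zero => exact zero_le_one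
  | succ n ih =>
    rw [stillWaiting_succ]
    have := hm.taggedStep_mono (F := 0) ih o
    rwa [map_zero] at this

lemma Market.Regular.stillWaiting_antitone (hm : m.Regular) (o : State) :
    Antitone fun n => stillWaiting m .H n o := by
  refine antitone_nat_of_succ_le fun n => ?_
  induction n generalizing o with
  | zero => exact (hm.taggedStep_one o).le
  | succ n ih =>
    rw [stillWaiting_succ m (n + 1)]
    nth_rewrite 2 [stillWaiting_succ m n]
    exact hm.taggedStep_mono ih o

lemma Market.Regular.tsum_sumTagged (hm : m.Regular) {π : PMF State}
    (hπ : IsSteadyState m .H π) {F : State → ℝ} (hF : ∀ s, 0 ≤ F s) :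
    ENNReal.ofReal m.totalRate * ∑' s, π s * ENNReal.ofReal (sumTagged F s) =
      ENNReal.ofReal m.totalRate * ∑' s, π s * ENNReal.ofReal (sumTagged (m.taggedStep F) s) +
      ENNReal.ofReal (m.rate .H) *
        ∑' s, π s * (ENNReal.ofReal (stayProb m .H .H s) * ENNReal.ofReal (F s)) := by
  have hR : ∀ s, 0 ≤ m.taggedStep F s := fun s => by
    have := hm.taggedStep_mono (F := 0) hF s
    rwa [map_zero] at this
  have hst := stayProb_nonneg hm.prob_mem .H .H
  rw [← hm.tsum_mul_gen hπ (sumTagged_nonneg hF), ← ENNReal.tsum_mul_left, ← ENNReal.tsum_mul_left,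
    ← ENNReal.tsum_add]
  refine tsum_congr fun s => ?_
  rw [hm.gen_sumTagged, ENNReal.ofReal_add (mul_nonneg hm.totalRate_pos.le (sumTagged_nonneg hR s))
    (mul_nonneg (hm.rate_pos .H).le (mul_nonneg (hst s) (hF s))),
    ENNReal.ofReal_mul hm.totalRate_pos.le, ENNReal.ofReal_mul (hm.rate_pos .H).le,
    ENNReal.ofReal_mul (hst s), mul_add, mul_left_comm, mul_left_comm (π s)]

/-- In a steady state with finitely many waiting `H` agents on average, a bounded function that is
harmonic for the chain seen from a waiting `H` agent vanishes: every such agent leaves. -/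
lemma Market.Regular.sumTagged_harmonic_eq_zero (hm : m.Regular) {π : PMF State}
    (hπ : IsSteadyState m .H π) (hfin : ∑' s : State, π s * ENNReal.ofReal s.1 ≠ ⊤)
    {f : State → ℝ} (hf1 : ∀ s, f s ∈ Icc (0 : ℝ) 1) (hf : m.taggedStep f = f) (s : State) :
    π s * ENNReal.ofReal (sumTagged f s) = 0 := by
  have hΛ := hm.totalRate_pos
  set k : State → ℝ := fun o => 1 - m.taggedStep (fun _ => 1) o with hk
  have hkpos : ∀ o, 0 < k o := fun o => sub_pos.2 (hm.taggedStep_one o)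
  -- Jensen with a defect: average f(x)² ≥ 2 f(o) f(x) - f(o)² over one step, whose total mass is
  -- only 1 - k(o).
  have hsq : ∀ o, f o ^ 2 + k o * f o ^ 2 ≤ m.taggedStep (fun o => f o ^ 2) o := by
    intro o
    have h1 := hm.taggedStep_mono (F := (2 * f o) • f - (f o ^ 2) • (fun _ => 1))
      (G := fun o => f o ^ 2) (fun x => by
        simp only [Pi.sub_apply, Pi.smul_apply, smul_eq_mul]; nlinarith [sq_nonneg (f x - f o)]) o
    rw [map_sub, map_smul, map_smul, hf] at h1
    simp only [Pi.sub_apply, Pi.smul_apply, smul_eq_mul] at h1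
    simp only [hk]
    nlinarith
  have hF0 : ∀ o, 0 ≤ f o ^ 2 := fun o => sq_nonneg _
  have hK0 : ∀ o, 0 ≤ k o * f o ^ 2 := fun o => mul_nonneg (hkpos o).le (hF0 o)
  -- In steady state one tagged step cannot increase the mean; with `hsq` this forces the defect
  -- term to vanish.
  have hle : ∑' s, π s * ENNReal.ofReal (sumTagged (m.taggedStep fun o => f o ^ 2) s) ≤
      ∑' s, π s * ENNReal.ofReal (sumTagged (fun o => f o ^ 2) s) := by
    have h0 : ENNReal.ofReal m.totalRate ≠ 0 := (ENNReal.ofReal_pos.2 hΛ).ne'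
    refine (ENNReal.mul_le_mul_iff_right h0 ENNReal.ofReal_ne_top).1 ?_
    rw [hm.tsum_sumTagged hπ hF0]
    exact le_self_add
  have hfin' : ∑' s, π s * ENNReal.ofReal (sumTagged (fun o => f o ^ 2) s) ≠ ⊤ := by
    refine ne_top_of_le_ne_top hfin (ENNReal.tsum_le_tsum fun s => ?_)
    gcongr
    exact mul_le_of_le_one_right s.1.cast_nonneg (pow_le_one₀ (hf1 _).1 (hf1 _).2)
  have hzero : ∑' s, π s * ENNReal.ofReal (sumTagged (fun o => k o * f o ^ 2) s) = 0 := by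
    have h1 : ∑' s, π s * ENNReal.ofReal (sumTagged (fun o => f o ^ 2) s) +
        ∑' s, π s * ENNReal.ofReal (sumTagged (fun o => k o * f o ^ 2) s) ≤
        ∑' s, π s * ENNReal.ofReal (sumTagged (fun o => f o ^ 2) s) + 0 := by
      rw [add_zero, ← ENNReal.tsum_add]
      refine le_trans (ENNReal.tsum_le_tsum fun s => ?_) hle
      rw [← mul_add, ← ENNReal.ofReal_add (sumTagged_nonneg hF0 s) (sumTagged_nonneg hK0 s)]
      gcongr
      have := sumTagged_mono hsq s
      rw [sumTagged] at this ⊢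
      rw [sumTagged, ← mul_add]
      exact this
    exact le_antisymm ((ENNReal.add_le_add_iff_left hfin').1 h1) bot_le
  rcases mul_eq_zero.1 (ENNReal.tsum_eq_zero.1 hzero s) with h | h
  · rw [h, zero_mul]
  · rw [ENNReal.ofReal_eq_zero] at h
    have h2 := le_antisymm h (sumTagged_nonneg hK0 s)
    rw [sumTagged, mul_eq_zero, mul_eq_zero, or_iff_right (hkpos _).ne', pow_eq_zero_iff two_ne_zero,
      ← mul_eq_zero] at h2
    rw [sumTagged, h2, ENNReal.ofReal_zero, mul_zero]

/-- The decreasing limit of the survival probabilities is harmonic, hence contributes nothing; h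
dominates the sums. -/
lemma Market.Regular.tendsto_tsum_stillWaiting (hm : m.Regular) {π : PMF State}
    (hπ : IsSteadyState m .H π) (hfin : ∑' s : State, π s * ENNReal.ofReal s.1 ≠ ⊤) :
    Tendsto (fun n => ∑' s, π s * ENNReal.ofReal (sumTagged (stillWaiting m .H n) s)) atTop
      (𝓝 0) := by
  have hle1 : ∀ n o, stillWaiting m .H n o ≤ 1 := fun n o =>
    hm.stillWaiting_antitone o (Nat.zero_le n)
  have hlim : ∀ o, Tendsto (fun n => stillWaiting m .H n o) atTop
      (𝓝 (⨅ n, stillWaiting m .H n o)) := fun o =>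
    tendsto_atTop_ciInf (hm.stillWaiting_antitone o)
      ⟨0, by rintro _ ⟨n, rfl⟩; exact hm.stillWaiting_nonneg n o⟩
  set f : State → ℝ := fun o => ⨅ n, stillWaiting m .H n o
  have hf1 : ∀ o, f o ∈ Icc (0 : ℝ) 1 := fun o =>
    ⟨ge_of_tendsto' (hlim o) fun n => hm.stillWaiting_nonneg n o,
      le_of_tendsto' (hlim o) fun n => hle1 n o⟩
  have hf : m.taggedStep f = f := by
    funext o
    refine tendsto_nhds_unique ?_ ((hlim o).comp (tendsto_add_atTop_nat 1))
    simp only [Function.comp_def, stillWaiting_succ, m.taggedStep_apply]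
    exact tendsto_finsetSum _ fun T _ => (((hlim _).const_mul _).add
      (tendsto_finsetSum _ fun i _ => (hlim _).const_mul _)).const_mul _
  have h0 : (0 : ℝ≥0∞) = ∑' s, π s * ENNReal.ofReal (sumTagged f s) := by
    simp only [hm.sumTagged_harmonic_eq_zero hπ hfin hf1 hf, tsum_zero]
  rw [h0]
  simp only [← MeasureTheory.lintegral_count] at hfin ⊢
  refine MeasureTheory.tendsto_lintegral_of_dominated_convergence _
    (fun n => Measurable.of_discrete) (fun n => ?_) hfin ?_
  · refine Eventually.of_forall fun s => ?_
    dsimp only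
    gcongr
    exact mul_le_of_le_one_right s.1.cast_nonneg (hle1 _ _)
  · refine Eventually.of_forall fun s => ?_
    exact ENNReal.Tendsto.const_mul (ENNReal.tendsto_ofReal ((hlim _).const_mul _))
      (Or.inr (π.apply_ne_top s))

/-- Up to the factor 1 / l, the integrand is the Gamma(n + 1, l) density: the chain spends mean time
1 / l between consecutive arrivals. -/
lemma lintegral_erlang {l : ℝ} (hl : 0 < l) (n : ℕ) :
    ∫⁻ t in Ioi (0 : ℝ), ENNReal.ofReal (Real.exp (-(l * t)) * (l * t) ^ n / (n.factorial : ℝ)) =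
      ENNReal.ofReal l⁻¹ := by
  have h1 := ProbabilityTheory.lintegral_gammaPDF_eq_one (a := n + 1) (r := l) (by positivity) hl
  have h2 : ∫⁻ t in Ioi (0 : ℝ), ProbabilityTheory.gammaPDF (n + 1) l t = 1 := by
    rw [← h1, ← MeasureTheory.lintegral_indicator measurableSet_Ioi]
    refine MeasureTheory.lintegral_congr_ae ?_
    have : ∀ᵐ t : ℝ, t ≠ 0 := by simp [MeasureTheory.ae_iff]
    filter_upwards [this] with t ht
    by_cases h : t ∈ Ioi (0 : ℝ)
    · rw [indicator_of_mem h]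
    · rw [indicator_of_notMem h, ProbabilityTheory.gammaPDF_of_neg]
      exact lt_of_le_of_ne (not_lt.1 h) ht
  rw [← mul_one (ENNReal.ofReal l⁻¹), ← h2,
    ← MeasureTheory.lintegral_const_mul' _ _ ENNReal.ofReal_ne_top]
  refine MeasureTheory.setLIntegral_congr_fun measurableSet_Ioi fun t ht => ?_
  have ht' : (0 : ℝ) < t := ht
  rw [ProbabilityTheory.gammaPDF_of_nonneg ht'.le, ← ENNReal.ofReal_mul (by positivity)]
  congr 1
  rw [Real.Gamma_nat_eq_factorial, add_sub_cancel_right, Real.rpow_natCast,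
    show ((n : ℝ) + 1) = ((n + 1 : ℕ) : ℝ) by push_cast; rfl, Real.rpow_natCast, mul_pow, pow_succ]
  field_simp

lemma Market.Regular.expectedWait_eq (hm : m.Regular) (o : State) :
    expectedWait m .H o =
      ENNReal.ofReal m.totalRate⁻¹ * ∑' n, ENNReal.ofReal (stillWaiting m .H n o) := by
  have hΛ := hm.totalRate_pos
  simp only [expectedWait, waitingTail]
  rw [MeasureTheory.lintegral_tsum fun n => by fun_prop, ← ENNReal.tsum_mul_left]
  refine tsum_congr fun n => ?_
  rw [← lintegral_erlang hΛ n, ← MeasureTheory.lintegral_mul_const' _ _ ENNReal.ofReal_ne_top]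
  refine MeasureTheory.setLIntegral_congr_fun measurableSet_Ioi fun t ht => ?_
  have ht' : (0 : ℝ) < t := ht
  exact ENNReal.ofReal_mul (by positivity)

/-- Little's law for agents of type `H`. -/
lemma Market.Regular.rate_mul_averageWaitH (hm : m.Regular) {π : PMF State}
    (hπ : IsSteadyState m .H π) (hfin : ∑' s : State, π s * ENNReal.ofReal s.1 ≠ ⊤) :
    ENNReal.ofReal (m.rate .H) * averageWaitH m .H π =
      ∑' s : State, π s * ENNReal.ofReal s.1 := by
  have hΛ := hm.totalRate_pos
  have hΛ0 : ENNReal.ofReal m.totalRate ≠ 0 := (ENNReal.ofReal_pos.2 hΛ).ne'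
  set A : ℕ → ℝ≥0∞ := fun n => ∑' s, π s * ENNReal.ofReal (sumTagged (stillWaiting m .H n) s) with hA
  set B : ℕ → ℝ≥0∞ := fun n => ∑' s, π s * (ENNReal.ofReal (stayProb m .H .H s) *
    ENNReal.ofReal (stillWaiting m .H n s)) with hB
  have hstep : ∀ n, ENNReal.ofReal m.totalRate * A n =
      ENNReal.ofReal m.totalRate * A (n + 1) + ENNReal.ofReal (m.rate .H) * B n := fun n =>
    hm.tsum_sumTagged hπ (hm.stillWaiting_nonneg n)
  -- Iterated over n arrivals, the one-step identity leaves the remainder A n, which tends to 0.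
  have hsum : ∀ n, ENNReal.ofReal m.totalRate * A 0 = ENNReal.ofReal m.totalRate * A n +
      ENNReal.ofReal (m.rate .H) * ∑ i ∈ Finset.range n, B i := by
    intro n
    induction n with
    | zero => simp
    | succ n ih => rw [ih, hstep, Finset.sum_range_succ, mul_add]; ring
  have hA0 : A 0 = ∑' s : State, π s * ENNReal.ofReal s.1 := by
    simp [hA, sumTagged, stillWaiting]
  have hlim : ENNReal.ofReal m.totalRate * A 0 = ENNReal.ofReal m.totalRate * 0 +
      ENNReal.ofReal (m.rate .H) * ∑' i, B i := by
    refine tendsto_nhds_unique (l := atTop (α := ℕ)) tendsto_const_nhds ?_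
    refine Tendsto.congr (fun n => (hsum n).symm) ?_
    exact (ENNReal.Tendsto.const_mul (hm.tendsto_tsum_stillWaiting hπ hfin)
      (Or.inr ENNReal.ofReal_ne_top)).add (ENNReal.Tendsto.const_mul
        (ENNReal.tendsto_nat_tsum B) (Or.inr ENNReal.ofReal_ne_top))
  have hW : averageWaitH m .H π = ENNReal.ofReal m.totalRate⁻¹ * ∑' i, B i := by
    rw [averageWaitH, hB, ENNReal.tsum_comm, ← ENNReal.tsum_mul_left]
    refine tsum_congr fun s => ?_
    rw [hm.expectedWait_eq, ENNReal.tsum_mul_left, ENNReal.tsum_mul_left]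
    ring
  rw [mul_zero, zero_add, hA0] at hlim
  rw [hW, mul_left_comm, ← hlim, ← mul_assoc, ← ENNReal.ofReal_mul (inv_nonneg.2 hΛ.le),
    inv_mul_cancel₀ hΛ.ne', ENNReal.ofReal_one, one_mul]

/-! ### The Lyapunov function and its drift -/

/-- `-log (1 - lamH / lamE)`: in the limit of small `pH`, the value of `pH * pE * h` at which arrivals
of `H` agents balance their matches with arriving `E` agents. -/
noncomputable def Market.load (m : Market) : ℝ := -Real.log (1 - m.lamH / m.lamE)

/-- Exponential rate in `h` at which the probability that an arriving `E` agent is compatible with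
none of `h` waiting `H` agents decays. -/
noncomputable def Market.decay (m : Market) : ℝ := -Real.log (m.miss .E .H)

/-- Coefficient of `e ^ 2` in the Lyapunov function. -/
noncomputable def Market.weightE (m : Market) : ℝ :=
  1 + m.lamH * m.load / (m.lamE * (1 - m.lamH / m.lamE))

/-- The centre is the real h at which (1 - pE pH)^h = 1 - lamH / lamE. -/
noncomputable def Market.lyapunov (m : Market) (s : State) : ℝ :=
  (s.1 - m.load / m.decay) ^ 2 + m.weightE * (s.2 : ℝ) ^ 2

noncomputable def Market.lyapunovDecrease (m : Market) (s : State) : ℝ :=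
  2 * m.lamE * ((s.1 - m.load / m.decay) * (1 - m.lamH / m.lamE - m.miss .E .H ^ s.1) +
    s.2 * m.miss .E .H ^ s.1)

/-- No term involves pH; the small-pH limit depends on this. -/
noncomputable def Market.lyapunovBound (m : Market) : ℝ :=
  m.weightE * (m.lamH + m.lamE) + 4 * m.weightE * m.lamE / m.pE ^ 2 +
    4 * m.lamH * (m.load / m.pE) ^ 2

/-- The standing assumptions of the Lyapunov estimate: easy-to-match agents arrive faster, and no pair
of agents is compatible with certainty. -/
structure Market.Balanced (m : Market) : Prop extends m.Regular where
  lamH_lt : m.lamH < m.lamE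
  miss_pos : 0 < m.miss .E .H

namespace Market.Balanced

lemma lamH_pos (hm : m.Balanced) : 0 < m.lamH := hm.rate_pos .H
lemma lamE_pos (hm : m.Balanced) : 0 < m.lamE := hm.rate_pos .E
lemma pH_pos (hm : m.Balanced) : 0 < m.pH := hm.prob_pos .H
lemma pE_pos (hm : m.Balanced) : 0 < m.pE := hm.prob_pos .E

lemma ratio_pos (hm : m.Balanced) : 0 < 1 - m.lamH / m.lamE :=
  sub_pos.2 ((div_lt_one hm.lamE_pos).2 hm.lamH_lt)

lemma load_pos (hm : m.Balanced) : 0 < m.load :=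
  neg_pos.2 (Real.log_neg hm.ratio_pos (sub_lt_self _ (div_pos hm.lamH_pos hm.lamE_pos)))

lemma decay_pos (hm : m.Balanced) : 0 < m.decay :=
  neg_pos.2 (Real.log_neg hm.miss_pos (hm.miss_lt_one _ _))

lemma exp_neg_load (hm : m.Balanced) : Real.exp (-m.load) = 1 - m.lamH / m.lamE := by
  rw [load, neg_neg, Real.exp_log hm.ratio_pos]

lemma exp_neg_decay_mul (hm : m.Balanced) (h : ℕ) :
    Real.exp (-(m.decay * h)) = m.miss .E .H ^ h := by
  rw [decay, neg_mul, neg_neg, mul_comm, Real.exp_nat_mul, Real.exp_log hm.miss_pos]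

lemma mul_le_decay (hm : m.Balanced) : m.pE * m.pH ≤ m.decay := by
  have := Real.log_le_sub_one_of_pos hm.miss_pos
  have h2 : m.miss .E .H = 1 - m.pE * m.pH := rfl
  rw [decay]; linarith

/-- The centre is at most of order 1 / pH, which keeps the drift error bounded as pH tends to 0. -/
lemma threshold_mul_le (hm : m.Balanced) : m.load / m.decay * m.pH ≤ m.load / m.pE := by
  rw [div_mul_eq_mul_div, div_le_div_iff₀ hm.decay_pos hm.pE_pos]
  nlinarith [hm.mul_le_decay, hm.load_pos]

lemma one_le_weightE (hm : m.Balanced) : 1 ≤ m.weightE :=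
  le_add_of_nonneg_right (div_nonneg (mul_nonneg hm.lamH_pos.le hm.load_pos.le)
    (mul_nonneg hm.lamE_pos.le hm.ratio_pos.le))

lemma lyapunov_nonneg (hm : m.Balanced) (s : State) : 0 ≤ m.lyapunov s :=
  add_nonneg (sq_nonneg _) (mul_nonneg (zero_le_one.trans hm.one_le_weightE) (sq_nonneg _))

lemma lyapunovBound_nonneg (hm : m.Balanced) : 0 ≤ m.lyapunovBound := by
  have h1 := zero_le_one.trans hm.one_le_weightE
  have h2 := hm.lamH_pos
  have h3 := hm.lamE_pos
  unfold lyapunovBound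
  positivity

/-- Both factors change sign at the centre, since the second is exp(-load) - exp(-decay * h). -/
lemma sub_mul_sub_nonneg (hm : m.Balanced) (h : ℕ) :
    0 ≤ (h - m.load / m.decay) * (1 - m.lamH / m.lamE - m.miss .E .H ^ h) := by
  rw [← hm.exp_neg_load, ← hm.exp_neg_decay_mul]
  have ha := hm.decay_pos
  rcases le_total (m.load / m.decay) h with hh | hh
  · refine mul_nonneg (sub_nonneg.2 hh) (sub_nonneg.2 (Real.exp_le_exp.2 ?_))
    rw [div_le_iff₀ ha] at hh; linarith
  · refine mul_nonneg_of_nonpos_of_nonpos (sub_nonpos.2 hh) (sub_nonpos.2 (Real.exp_le_exp.2 ?_))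
    rw [le_div_iff₀ ha] at hh; linarith

lemma lyapunovDecrease_nonneg (hm : m.Balanced) (s : State) : 0 ≤ m.lyapunovDecrease s := by
  have := hm.sub_mul_sub_nonneg s.1
  have h2 := hm.lamE_pos
  have h3 := hm.miss_pos
  unfold lyapunovDecrease
  positivity

end Market.Balanced

lemma one_sub_pow_le {x : ℝ} (h1 : x ≤ 1) (n : ℕ) : 1 - (1 - x) ^ n ≤ n * x := by
  have := one_add_mul_le_pow (a := -x) (by linarith) n
  rw [← sub_eq_add_neg] at this
  linarith

/-- Bernoulli's inequality for (1 + q²)^n, combined with (1 + q²)(1 - q²) ≤ 1. -/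
lemma mul_one_sub_sq_pow_le {q : ℝ} (h0 : 0 < q) (h1 : q ≤ 1) (n : ℕ) :
    n * (1 - q * q) ^ n ≤ 1 / q ^ 2 := by
  have hq : q * q ≤ 1 := by nlinarith
  have h2 := one_add_mul_le_pow (a := q * q) (by nlinarith) n
  have h3 : (1 + q * q) ^ n * (1 - q * q) ^ n ≤ 1 := by
    rw [← mul_pow]
    exact pow_le_one₀ (by nlinarith) (by nlinarith [sq_nonneg (q * q)])
  have h4 : 0 ≤ (1 - q * q) ^ n := pow_nonneg (by linarith) n
  rw [le_div_iff₀ (by positivity)]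
  nlinarith

lemma gen_sq_add_sq (m : Market) (c K : ℝ) (h e : ℕ) :
    m.gen (fun s => (s.1 - c) ^ 2 + K * (s.2 : ℝ) ^ 2) (h, e) =
      (m.lamH + m.lamE) * ((h - c) ^ 2 + K * (e : ℝ) ^ 2) +
      (2 * (h - c) * (m.lamH * (m.miss .H .H ^ h * m.miss .H .E ^ e) -
          m.lamH * (1 - m.miss .H .H ^ h) - m.lamE * (1 - m.miss .E .H ^ h)) +
        (m.lamH * (m.miss .H .H ^ h * m.miss .H .E ^ e + (1 - m.miss .H .H ^ h)) +
          m.lamE * (1 - m.miss .E .H ^ h)) +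
        K * (2 * e * (m.lamE * (m.miss .E .H ^ h * m.miss .E .E ^ e) -
            m.lamH * (m.miss .H .H ^ h * (1 - m.miss .H .E ^ e)) -
            m.lamE * (m.miss .E .H ^ h * (1 - m.miss .E .E ^ e))) +
          (m.lamE * m.miss .E .H ^ h +
            m.lamH * (m.miss .H .H ^ h * (1 - m.miss .H .E ^ e))))) := by
  simp only [Market.gen_apply, sum_agentType, addAgent, removeAgent, Market.rate]
  rcases h with _ | h <;> rcases e with _ | e <;>
    simp only [Nat.add_sub_cancel, pow_zero, sub_self, zero_mul, mul_zero] <;> push_cast <;> ring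

/-- Here u, v, w, z are the probabilities that a newcomer misses every waiting agent of one type: u
for `E` meeting `H`, v for `H` meeting `H`, w for `H` meeting `E`, z for `E` meeting `E`; c is the
centre. -/
lemma drift_estimate {lH lE h e c K u v w z ρ p q X : ℝ} (hlH : 0 ≤ lH) (hlE : 0 < lE)
    (hh : 0 ≤ h) (he : 0 ≤ e) (hc : 0 ≤ c) (hu0 : 0 ≤ u) (hu1 : u ≤ 1) (hv0 : 0 ≤ v) (hv1 : v ≤ 1)
    (hw0 : 0 ≤ w) (hw1 : w ≤ 1) (hρ : 0 < ρ) (hp : 0 ≤ p) (hq : 0 < q)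
    (hX : 0 ≤ X) (hbal : lH = lE * (1 - ρ)) (hv : 1 - v ≤ h * (p * p)) (hw : 1 - w ≤ e * (p * q))
    (hcp : c * p ≤ X / q) (hρu : h < c → ρ ≤ u) (hez : e * z ≤ 1 / q ^ 2)
    (hK : K = 1 + lH * X / (lE * ρ)) :
    2 * (h - c) * (lH * (v * w) - lH * (1 - v) - lE * (1 - u)) +
        (lH * (v * w + (1 - v)) + lE * (1 - u)) +
        K * (2 * e * (lE * (u * z) - lH * (v * (1 - w)) - lE * (u * (1 - z))) +
          (lE * u + lH * (v * (1 - w)))) ≤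
      -(2 * lE * ((h - c) * (ρ - u) + e * u)) +
        (K * (lH + lE) + 4 * K * lE / q ^ 2 + 4 * lH * (X / q) ^ 2) := by
  have hK1 : 1 ≤ K := by rw [hK]; exact le_add_of_nonneg_right (by positivity)
  have hvw : v * w ≤ v := mul_le_of_le_one_right hv0 hw1
  have hXq : 0 ≤ X / q := by positivity
  -- The first term is the idealized drift; the second is the correction for `H` newcomers matched
  -- on arrival.
  have t1 : 2 * (h - c) * (lH * (v * w) - lH * (1 - v) - lE * (1 - u)) =
      -(2 * lE * ((h - c) * (ρ - u))) + 2 * lH * ((c - h) * ((1 - v * w) + (1 - v))) := by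
    linear_combination 2 * (h - c) * hbal
  -- K is chosen for this identity: below the centre u ≥ ρ, so the extra weight K - 1 on e u absorbs
  -- the correction lH * X * e.
  have hKE : (K - 1) * lE * ρ = lH * X := by rw [hK]; field_simp; ring
  -- Above the centre the correction helps. Below it, the part from `H` partners is bounded because
  -- c * p ≤ X / q, and the part from `E` partners is linear in e.
  have t2 : 2 * lH * ((c - h) * ((1 - v * w) + (1 - v))) ≤
      4 * lH * (X / q) ^ 2 + 2 * (K - 1) * lE * (e * u) := by
    rcases le_or_gt c h with hch | hch
    · have h1 : (c - h) * ((1 - v * w) + (1 - v)) ≤ 0 :=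
        mul_nonpos_of_nonpos_of_nonneg (by linarith) (by linarith)
      have h2 : 0 ≤ 4 * lH * (X / q) ^ 2 := by positivity
      have h3 : 0 ≤ 2 * (K - 1) * lE * (e * u) :=
        mul_nonneg (mul_nonneg (by linarith) hlE.le) (by positivity)
      nlinarith
    · have h1 : (1 - v * w) + (1 - v) ≤ 2 * (c * (p * p)) + e * (p * q) := by
        have : h * (p * p) ≤ c * (p * p) := by gcongr
        nlinarith [mul_nonneg (sub_nonneg.2 hv1) (sub_nonneg.2 hw1)]
      have h2 : (c - h) * ((1 - v * w) + (1 - v)) ≤ c * (2 * (c * (p * p)) + e * (p * q)) :=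
        mul_le_mul (by linarith) h1 (by linarith) hc
      have h3 : (c * p) * (c * p) ≤ (X / q) * (X / q) :=
        mul_le_mul hcp hcp (by positivity) hXq
      have h4 : c * p * q ≤ X := by rwa [le_div_iff₀ hq] at hcp
      have h5 : lH * X ≤ (K - 1) * lE * u := by
        rw [← hKE]
        exact mul_le_mul_of_nonneg_left (hρu hch) (mul_nonneg (by linarith) hlE.le)
      have h6 : c * (2 * (c * (p * p)) + e * (p * q)) ≤ 2 * (X / q) ^ 2 + e * X := by
        nlinarith [mul_le_mul_of_nonneg_left h4 he]
      nlinarith [mul_le_mul_of_nonneg_left (h2.trans h6) hlH, mul_le_mul_of_nonneg_left h5 he]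
  have t3 : 2 * e * (lE * (u * z) - lH * (v * (1 - w)) - lE * (u * (1 - z))) ≤
      -(2 * lE * (e * u)) + 4 * lE * (1 / q ^ 2) := by
    have h1 : 0 ≤ 2 * e * (lH * (v * (1 - w))) :=
      mul_nonneg (by positivity) (mul_nonneg hlH (mul_nonneg hv0 (by linarith)))
    have h2 : u * (e * z) ≤ 1 / q ^ 2 :=
      (mul_le_mul_of_nonneg_left hez hu0).trans (mul_le_of_le_one_left (by positivity) hu1)
    have h3 := mul_le_mul_of_nonneg_left h2 (show 0 ≤ 4 * lE by positivity)
    linarith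
  have t4 : (lH * (v * w + (1 - v)) + lE * (1 - u)) ≤
      K * (lH * (v * w + (1 - v)) + lE * (1 - u)) := by
    have : 0 ≤ lH * (v * w + (1 - v)) + lE * (1 - u) := by
      have := mul_nonneg hv0 hw0
      exact add_nonneg (mul_nonneg hlH (by linarith)) (mul_nonneg hlE.le (by linarith))
    exact le_mul_of_one_le_left this hK1
  have t3' := mul_le_mul_of_nonneg_left t3 (zero_le_one.trans hK1)
  have t5 : 4 * K * lE / q ^ 2 = K * (4 * lE * (1 / q ^ 2)) := by ring
  rw [t1, t5]
  linarith

namespace Market.Balanced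

lemma drift (hm : m.Balanced) (s : State) :
    m.gen m.lyapunov s + m.lyapunovDecrease s ≤ m.totalRate * m.lyapunov s + m.lyapunovBound := by
  obtain ⟨h, e⟩ := s
  have hΛ : m.totalRate = m.lamH + m.lamE := by rw [Market.totalRate, sum_agentType]; rfl
  have hmiss : m.miss .H .E = m.miss .E .H := by simp only [miss, mul_comm]
  have n0 := miss_nonneg hm.prob_mem
  have n1 := miss_le_one hm.prob_mem
  have hu : h < m.load / m.decay → 1 - m.lamH / m.lamE ≤ m.miss .E .H ^ h := by
    intro hh
    rw [← hm.exp_neg_load, ← hm.exp_neg_decay_mul, Real.exp_le_exp, neg_le_neg_iff]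
    rw [lt_div_iff₀ hm.decay_pos] at hh
    linarith
  have est := drift_estimate (h := h) (e := e) (c := m.load / m.decay) (K := m.weightE)
    (u := m.miss .E .H ^ h) (v := m.miss .H .H ^ h) (w := m.miss .H .E ^ e)
    (z := m.miss .E .E ^ e) (ρ := 1 - m.lamH / m.lamE) (p := m.pH) (q := m.pE) (X := m.load)
    hm.lamH_pos.le hm.lamE_pos h.cast_nonneg e.cast_nonneg
    (div_nonneg hm.load_pos.le hm.decay_pos.le)
    (pow_nonneg (n0 _ _) _) (pow_le_one₀ (n0 _ _) (n1 _ _)) (pow_nonneg (n0 _ _) _)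
    (pow_le_one₀ (n0 _ _) (n1 _ _)) (pow_nonneg (n0 _ _) _) (pow_le_one₀ (n0 _ _) (n1 _ _))
    hm.ratio_pos hm.pH_pos.le hm.pE_pos hm.load_pos.le
    (by have := hm.lamE_pos.ne'; field_simp; ring)
    (one_sub_pow_le (mul_le_one₀ (hm.prob_mem .H).2 (hm.prob_mem .H).1 (hm.prob_mem .H).2) h)
    (one_sub_pow_le (mul_le_one₀ (hm.prob_mem .H).2 (hm.prob_mem .E).1 (hm.prob_mem .E).2) e)
    hm.threshold_mul_le hu
    (mul_one_sub_sq_pow_le hm.pE_pos (hm.prob_mem .E).2 e) rfl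
  have hgen := gen_sq_add_sq m (m.load / m.decay) m.weightE h e
  change m.gen (fun s => (s.1 - m.load / m.decay) ^ 2 + m.weightE * (s.2 : ℝ) ^ 2) (h, e) + _ ≤ _
  rw [hgen, hΛ]
  simp only [lyapunov, lyapunovDecrease, lyapunovBound]
  linarith

lemma tsum_lyapunovDecrease_le (hm : m.Balanced) {π : PMF State} (hπ : IsSteadyState m .H π) :
    ∑' s, π s * ENNReal.ofReal (m.lyapunovDecrease s) ≤ ENNReal.ofReal m.lyapunovBound :=
  hm.toRegular.tsum_le_of_drift hπ hm.lyapunov_nonneg hm.lyapunovDecrease_nonneg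
    hm.lyapunovBound_nonneg hm.drift

end Market.Balanced

/-! ### Concentration of the number of waiting `H` agents -/

/-- Outside the δ-window around x the exponentials differ by at least exp(-x)(1 - exp(-δ)), whose
inverse is M. On the left this uses exp(δ) + exp(-δ) ≥ 2. -/
lemma exists_abs_sub_le (x : ℝ) {δ : ℝ} (hδ : 0 < δ) :
    ∃ M : ℝ, 0 ≤ M ∧ ∀ y, |y - x| ≤ δ + M * ((y - x) * (Real.exp (-x) - Real.exp (-y))) := by
  have hd : 0 < 1 - Real.exp (-δ) := by
    have : Real.exp (-δ) < 1 := Real.exp_zero ▸ Real.exp_lt_exp.2 (by linarith)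
    linarith
  have hx := Real.exp_pos (-x)
  have hc : 0 < Real.exp (-x) * (1 - Real.exp (-δ)) := mul_pos hx hd
  refine ⟨(Real.exp (-x) * (1 - Real.exp (-δ)))⁻¹, inv_nonneg.2 hc.le, fun y => ?_⟩
  have key : ∀ t b : ℝ, 0 ≤ t → Real.exp (-x) * (1 - Real.exp (-δ)) ≤ b →
      t ≤ (Real.exp (-x) * (1 - Real.exp (-δ)))⁻¹ * (t * b) := fun t b ht hb => by
    rw [inv_mul_eq_div, le_div_iff₀ hc]
    exact mul_le_mul_of_nonneg_left hb ht
  rcases lt_or_ge (y - x) (-δ) with h | h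
  · have h1 : Real.exp (-x) * Real.exp δ ≤ Real.exp (-y) := by
      rw [← Real.exp_add]; exact Real.exp_le_exp.2 (by linarith)
    have h2 : 2 ≤ Real.exp δ + Real.exp (-δ) := by
      have := Real.add_one_le_exp δ; have := Real.add_one_le_exp (-δ); linarith
    have := key (-(y - x)) (Real.exp (-y) - Real.exp (-x)) (by linarith) (by nlinarith)
    rw [abs_of_neg (by linarith)]
    rw [show (y - x) * (Real.exp (-x) - Real.exp (-y)) =
      -(y - x) * (Real.exp (-y) - Real.exp (-x)) by ring]
    linarith
  · rcases le_or_gt (y - x) δ with h' | h'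
    · have : 0 ≤ (y - x) * (Real.exp (-x) - Real.exp (-y)) := by
        rcases le_total x y with hxy | hxy
        · exact mul_nonneg (by linarith) (sub_nonneg.2 (Real.exp_le_exp.2 (by linarith)))
        · exact mul_nonneg_of_nonpos_of_nonpos (by linarith)
            (sub_nonpos.2 (Real.exp_le_exp.2 (by linarith)))
      have h3 : |y - x| ≤ δ := abs_le.2 ⟨h, h'⟩
      have := mul_nonneg (inv_nonneg.2 hc.le) this
      linarith
    · have h1 : Real.exp (-y) ≤ Real.exp (-x) * Real.exp (-δ) := by
        rw [← Real.exp_add]; exact Real.exp_le_exp.2 (by linarith)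
      have := key (y - x) (Real.exp (-x) - Real.exp (-y)) (by linarith) (by linarith)
      rw [abs_of_pos (by linarith)]
      linarith

lemma tsum_mul_le_add {S : Type*} (π : PMF S) {f g : S → ℝ} {c k : ℝ} (hc : 0 ≤ c) (hk : 0 ≤ k)
    (hg : ∀ s, 0 ≤ g s) (h : ∀ s, f s ≤ c + k * g s) :
    ∑' s, π s * ENNReal.ofReal (f s) ≤
      ENNReal.ofReal c + ENNReal.ofReal k * ∑' s, π s * ENNReal.ofReal (g s) := by
  calc ∑' s, π s * ENNReal.ofReal (f s)
      ≤ ∑' s, (π s * ENNReal.ofReal c + ENNReal.ofReal k * (π s * ENNReal.ofReal (g s))) := by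
        refine ENNReal.tsum_le_tsum fun s => ?_
        rw [mul_left_comm, ← mul_add, ← ENNReal.ofReal_mul hk,
          ← ENNReal.ofReal_add hc (mul_nonneg hk (hg s))]
        gcongr
        exact h s
    _ = _ := by
        rw [ENNReal.tsum_add, ENNReal.tsum_mul_right, π.tsum_coe, one_mul, ENNReal.tsum_mul_left]

/-- Average number of waiting agents of type `H`. -/
noncomputable def meanH (π : PMF State) : ℝ≥0∞ := ∑' s : State, π s * ENNReal.ofReal s.1

namespace Market.Balanced

/-- Rescaling h to decay * h puts the factor decay before `lyapunovDecrease`, so the error vanishes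
with pH. -/
lemma abs_decay_mul_sub_le (hm : m.Balanced) {δ M : ℝ} (hM0 : 0 ≤ M)
    (hM : ∀ y, |y - m.load| ≤ δ + M * ((y - m.load) * (Real.exp (-m.load) - Real.exp (-y))))
    (s : State) :
    |m.decay * s.1 - m.load| ≤ δ + M * m.decay / (2 * m.lamE) * m.lyapunovDecrease s := by
  refine (hM (m.decay * s.1)).trans (add_le_add le_rfl ?_)
  have ha := hm.decay_pos
  have hl := hm.lamE_pos
  have hu := pow_pos hm.miss_pos s.1
  rw [hm.exp_neg_load, hm.exp_neg_decay_mul, lyapunovDecrease]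
  have e1 : M * m.decay / (2 * m.lamE) * (2 * m.lamE * ((s.1 - m.load / m.decay) *
      (1 - m.lamH / m.lamE - m.miss .E .H ^ s.1) + s.2 * m.miss .E .H ^ s.1)) =
      M * ((m.decay * s.1 - m.load) * (1 - m.lamH / m.lamE - m.miss .E .H ^ s.1)) +
        M * m.decay * (s.2 * m.miss .E .H ^ s.1) := by
    field_simp
  rw [e1]
  exact le_add_of_nonneg_right (by positivity)

lemma meanH_ne_top (hm : m.Balanced) {π : PMF State} (hπ : IsSteadyState m .H π) :
    meanH π ≠ ⊤ := by
  obtain ⟨M, hM0, hM⟩ := exists_abs_sub_le m.load one_pos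
  have ha := hm.decay_pos
  have hl := hm.lamE_pos
  have h1 := tsum_mul_le_add π (f := fun s => (s.1 : ℝ)) (c := (m.load + 1) / m.decay)
    (k := M / (2 * m.lamE)) (div_nonneg (by linarith [hm.load_pos]) ha.le) (by positivity)
    hm.lyapunovDecrease_nonneg fun s => by
      have := (abs_le.1 (hm.abs_decay_mul_sub_le hM0 hM s)).2
      rw [← mul_le_mul_iff_right₀ ha, mul_add, mul_div_cancel₀ _ ha.ne']
      have e : m.decay * (M / (2 * m.lamE) * m.lyapunovDecrease s) =
        M * m.decay / (2 * m.lamE) * m.lyapunovDecrease s := by ring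
      linarith
  exact ne_top_of_le_ne_top (ENNReal.add_ne_top.2 ⟨ENNReal.ofReal_ne_top,
    ENNReal.mul_ne_top ENNReal.ofReal_ne_top
      (ne_top_of_le_ne_top ENNReal.ofReal_ne_top (hm.tsum_lyapunovDecrease_le hπ))⟩) h1

lemma abs_decay_mul_meanH_sub_le (hm : m.Balanced) {π : PMF State}
    (hπ : IsSteadyState m .H π) {δ M : ℝ} (hδ : 0 ≤ δ) (hM0 : 0 ≤ M)
    (hM : ∀ y, |y - m.load| ≤ δ + M * ((y - m.load) * (Real.exp (-m.load) - Real.exp (-y)))) :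
    |m.decay * (meanH π).toReal - m.load| ≤
      δ + M * m.decay / (2 * m.lamE) * m.lyapunovBound := by
  have ha := hm.decay_pos
  have hl := hm.lamE_pos
  have hX := hm.load_pos
  have hE := hm.meanH_ne_top hπ
  have hC := hm.lyapunovBound_nonneg
  have hg := hm.tsum_lyapunovDecrease_le hπ
  set k := M * m.decay / (2 * m.lamE) with hk
  have hk0 : 0 ≤ k := by positivity
  have hpt := fun s => abs_le.1 (hm.abs_decay_mul_sub_le hM0 hM s)
  have hmul : ∑' s, π s * ENNReal.ofReal (m.decay * s.1) = ENNReal.ofReal m.decay * meanH π := by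
    rw [meanH, ← ENNReal.tsum_mul_left]
    simp_rw [ENNReal.ofReal_mul ha.le, mul_left_comm]
  have hconst : ∑' s, π s * ENNReal.ofReal m.load = ENNReal.ofReal m.load := by
    rw [ENNReal.tsum_mul_right, π.tsum_coe, one_mul]
  have hEr : ENNReal.ofReal m.decay * meanH π = ENNReal.ofReal (m.decay * (meanH π).toReal) := by
    rw [ENNReal.ofReal_mul ha.le, ENNReal.ofReal_toReal hE]
  have hup := tsum_mul_le_add π (f := fun s => m.decay * (s.1 : ℝ)) (c := m.load + δ) (k := k)
    (by linarith) hk0 hm.lyapunovDecrease_nonneg fun s => by linarith [(hpt s).2]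
  -- The lower bound is stated as an upper bound for the constant `load`, avoiding subtraction in
  -- `ℝ≥0∞`.
  have hlo := tsum_mul_le_add π (f := fun _ => m.load) (c := δ) (k := 1)
    (g := fun s => m.decay * (s.1 : ℝ) + k * m.lyapunovDecrease s) hδ zero_le_one
    (fun s => add_nonneg (by positivity) (mul_nonneg hk0 (hm.lyapunovDecrease_nonneg s)))
    fun s => by linarith [(hpt s).1]
  have hsplit : ∑' s, π s * ENNReal.ofReal (m.decay * (s.1 : ℝ) + k * m.lyapunovDecrease s) =
      ENNReal.ofReal m.decay * meanH π +
        ENNReal.ofReal k * ∑' s, π s * ENNReal.ofReal (m.lyapunovDecrease s) := by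
    rw [← hmul, ← ENNReal.tsum_mul_left, ← ENNReal.tsum_add]
    refine tsum_congr fun s => ?_
    rw [ENNReal.ofReal_add (by positivity) (mul_nonneg hk0 (hm.lyapunovDecrease_nonneg s)),
      ENNReal.ofReal_mul hk0, mul_add, mul_left_comm (π s) (ENNReal.ofReal k)]
  have hkC : ENNReal.ofReal k * ∑' s, π s * ENNReal.ofReal (m.lyapunovDecrease s) ≤
      ENNReal.ofReal (k * m.lyapunovBound) := by
    rw [ENNReal.ofReal_mul hk0]; gcongr
  have hkC0 : 0 ≤ k * m.lyapunovBound := mul_nonneg hk0 hC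
  rw [abs_le]
  constructor
  · rw [hconst, hsplit, ENNReal.ofReal_one, one_mul, hEr] at hlo
    have h2 := hlo.trans (add_le_add le_rfl (add_le_add le_rfl hkC))
    rw [← ENNReal.ofReal_add (by positivity) hkC0, ← ENNReal.ofReal_add hδ (by positivity),
      ENNReal.ofReal_le_ofReal_iff (by positivity)] at h2
    linarith
  · rw [hmul, hEr] at hup
    have h2 := hup.trans (add_le_add le_rfl hkC)
    rw [← ENNReal.ofReal_add (by linarith) hkC0,
      ENNReal.ofReal_le_ofReal_iff (by linarith)] at h2
    linarith

lemma exists_steadyState (hm : m.Balanced) : ∃ π : PMF State, IsSteadyState m .H π := by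
  refine hm.toRegular.exists_steadyState hm.lyapunov_nonneg hm.lyapunovDecrease_nonneg
    (fun B => ?_) hm.drift
  obtain ⟨M, hM0, hM⟩ := exists_abs_sub_le m.load one_pos
  have ha := hm.decay_pos
  have hl := hm.lamE_pos
  have hr := hm.miss_pos
  -- A bound on `lyapunovDecrease` first bounds h by h₀; then e * miss^h ≥ e * miss^h₀ bounds e.
  obtain ⟨h₀, hh₀⟩ := exists_nat_ge
    ((m.load + 1 + M * m.decay / (2 * m.lamE) * B) / m.decay)
  obtain ⟨e₀, he₀⟩ := exists_nat_ge (B / (2 * m.lamE * m.miss .E .H ^ h₀))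
  refine ((finite_Iic h₀).prod (finite_Iic e₀)).subset fun s hs => ?_
  have hs' : m.lyapunovDecrease s ≤ B := hs
  have h1 : (s.1 : ℝ) ≤ h₀ := by
    refine le_trans ?_ hh₀
    rw [le_div_iff₀ ha]
    have h2 := (abs_le.1 (hm.abs_decay_mul_sub_le hM0 hM s)).2
    have h3 : M * m.decay / (2 * m.lamE) * m.lyapunovDecrease s ≤
      M * m.decay / (2 * m.lamE) * B := mul_le_mul_of_nonneg_left hs' (by positivity)
    linarith
  have h1' : s.1 ≤ h₀ := by exact_mod_cast h1
  refine ⟨h1', ?_⟩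
  have h2 : (s.2 : ℝ) ≤ e₀ := by
    refine le_trans ?_ he₀
    rw [le_div_iff₀ (by positivity)]
    refine le_trans ?_ hs'
    have h3 := hm.sub_mul_sub_nonneg s.1
    have h4 : m.miss .E .H ^ h₀ ≤ m.miss .E .H ^ s.1 :=
      pow_le_pow_of_le_one hr.le (miss_le_one hm.prob_mem _ _) h1'
    have h5 : (s.2 : ℝ) * m.miss .E .H ^ h₀ ≤ s.2 * m.miss .E .H ^ s.1 :=
      mul_le_mul_of_nonneg_left h4 s.2.cast_nonneg
    rw [lyapunovDecrease]
    nlinarith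
  exact_mod_cast h2

end Market.Balanced

/-! ### The case of certain compatibility -/

section Certain

/-- Every newcomer is matched unless the market is empty, so n = h + e goes to n - 1, or from 0 to
1; equality holds in both cases. -/
lemma Market.drift_of_miss_eq_zero (m : Market) (h0 : ∀ T S, m.miss T S = 0)
    (s : State) :
    m.gen (fun s => ((s.1 : ℝ) + s.2) ^ 2) s + m.totalRate * (2 * (s.1 + s.2)) ≤
      m.totalRate * ((s.1 : ℝ) + s.2) ^ 2 + m.totalRate := by
  have hΛ : m.totalRate = m.rate .H + m.rate .E := by rw [Market.totalRate, sum_agentType]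
  obtain ⟨_ | h, _ | e⟩ := s <;>
  · simp only [Market.gen_apply, sum_agentType, h0, hΛ, addAgent, removeAgent]
    apply le_of_eq
    simp
    try ring

lemma Market.Regular.exists_steadyState_of_miss_eq_zero (hm : m.Regular)
    (h0 : ∀ T S, m.miss T S = 0) : ∃ π : PMF State, IsSteadyState m .H π := by
  have hΛ := hm.totalRate_pos
  refine hm.exists_steadyState (fun s => sq_nonneg _) (fun s => by positivity) (fun B => ?_)
    (m.drift_of_miss_eq_zero h0)
  obtain ⟨n, hn⟩ := exists_nat_ge (B / m.totalRate)
  refine ((finite_Iic n).prod (finite_Iic n)).subset fun s hs => ?_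
  have hs' : m.totalRate * (2 * ((s.1 : ℝ) + s.2)) ≤ B := hs
  rw [div_le_iff₀ hΛ] at hn
  have h1 : (2 * ((s.1 : ℝ) + s.2)) ≤ n := by
    refine le_of_mul_le_mul_left ?_ hΛ
    linarith
  have h2 : 2 * (s.1 + s.2) ≤ n := by exact_mod_cast h1
  constructor <;> simp only [mem_Iic] <;> omega

lemma Market.Regular.meanH_ne_top_of_miss_eq_zero (hm : m.Regular)
    (h0 : ∀ T S, m.miss T S = 0) {π : PMF State} (hπ : IsSteadyState m .H π) : meanH π ≠ ⊤ := by
  have hΛ := hm.totalRate_pos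
  have h1 := hm.tsum_le_of_drift hπ (fun s => sq_nonneg _) (fun s => by positivity) hΛ.le
    (m.drift_of_miss_eq_zero h0)
  have h2 := tsum_mul_le_add π (f := fun s => (s.1 : ℝ)) (c := 0) (k := m.totalRate⁻¹) le_rfl
    (inv_nonneg.2 hΛ.le) (g := fun s => m.totalRate * (2 * ((s.1 : ℝ) + s.2)))
    (fun s => by positivity) fun s => by
      rw [zero_add, inv_mul_cancel_left₀ hΛ.ne']
      linarith [s.1.cast_nonneg (α := ℝ), s.2.cast_nonneg (α := ℝ)]
  exact ne_top_of_le_ne_top (ENNReal.add_ne_top.2 ⟨ENNReal.ofReal_ne_top,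
    ENNReal.mul_ne_top ENNReal.ofReal_ne_top (ne_top_of_le_ne_top ENNReal.ofReal_ne_top h1)⟩) h2

end Certain

/-! ### Finite waits, the limit and its monotonicity -/

lemma Market.Regular.balanced_or_miss_eq_zero (hm : m.Regular) (hlt : m.lamH < m.lamE) :
    m.Balanced ∨ ∀ T S, m.miss T S = 0 := by
  rcases (miss_nonneg hm.prob_mem .E .H).lt_or_eq with h | h
  · exact Or.inl ⟨hm, hlt, h⟩
  · right
    have h1 := hm.prob_mem
    have h2 : m.prob .E * m.prob .H = 1 := by simp only [miss] at h; linarith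
    have hE : m.prob .E = 1 := by nlinarith [(h1 .E).1, (h1 .E).2, (h1 .H).1, (h1 .H).2]
    have hH : m.prob .H = 1 := by rw [hE, one_mul] at h2; exact h2
    rintro (_ | _) (_ | _) <;> simp [miss, hE, hH]

lemma Market.Regular.meanH_ne_top (hm : m.Regular) (hlt : m.lamH < m.lamE) {π : PMF State}
    (hπ : IsSteadyState m .H π) : meanH π ≠ ⊤ :=
  (hm.balanced_or_miss_eq_zero hlt).elim (fun h => h.meanH_ne_top hπ)
    fun h => hm.meanH_ne_top_of_miss_eq_zero h hπ

lemma Market.Regular.existsUnique_steadyState (hm : m.Regular) (hlt : m.lamH < m.lamE) :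
    ∃! π : PMF State, IsSteadyState m .H π := by
  obtain ⟨π, hπ⟩ := (hm.balanced_or_miss_eq_zero hlt).elim (fun h => h.exists_steadyState)
    hm.exists_steadyState_of_miss_eq_zero
  exact ⟨π, hπ, fun π' hπ' => hm.steadyState_unique hπ' hπ⟩

lemma Market.Regular.averageWaitH_ne_top (hm : m.Regular) (hlt : m.lamH < m.lamE) {π : PMF State}
    (hπ : IsSteadyState m .H π) : averageWaitH m .H π ≠ ⊤ := by
  have h1 := hm.meanH_ne_top hlt hπ
  have h2 := hm.rate_mul_averageWaitH hπ h1
  intro h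
  rw [h, ENNReal.mul_top (ENNReal.ofReal_pos.2 (hm.rate_pos .H)).ne'] at h2
  exact h1 h2.symm

lemma Market.Regular.toReal_averageWaitH (hm : m.Regular) (hlt : m.lamH < m.lamE) {π : PMF State}
    (hπ : IsSteadyState m .H π) :
    (averageWaitH m .H π).toReal = (meanH π).toReal / m.lamH := by
  have h2 := congrArg ENNReal.toReal (hm.rate_mul_averageWaitH hπ (hm.meanH_ne_top hlt hπ))
  have hp : 0 < m.lamH := hm.rate_pos .H
  rw [ENNReal.toReal_mul, ENNReal.toReal_ofReal (hm.rate_pos .H).le] at h2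
  rw [eq_div_iff hp.ne', mul_comm]
  exact h2

lemma regular_mk {lamH lamE pH pE : ℝ} (h1 : 0 < lamH) (h2 : 0 < lamE) (h3 : pH ∈ Ioc (0 : ℝ) 1)
    (h4 : pE ∈ Ioc (0 : ℝ) 1) : Market.Regular ⟨lamH, lamE, pH, pE⟩ where
  rate_pos := by rintro (_ | _); exacts [h1, h2]
  prob_pos := by rintro (_ | _); exacts [h3.1, h4.1]
  prob_le_one := by rintro (_ | _); exacts [h3.2, h4.2]

/-- Up to a negative constant factor, the function is the secant slope of the strictly convex -log
between 1 and 1 - x / l, which moves left as x grows. -/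
lemma strictMonoOn_neg_log_one_sub_div {l q : ℝ} (hl : 0 < l) (hq : 0 < q) :
    StrictMonoOn (fun x => -Real.log (1 - x / l) / (q * x)) (Ioo 0 l) := by
  intro x hx y hy hxy
  have hxl : x / l < 1 := (div_lt_one hl).2 hx.2
  have hyl : y / l < 1 := (div_lt_one hl).2 hy.2
  have hx0 : 0 < x / l := div_pos hx.1 hl
  have hxyl : x / l < y / l := by gcongr
  have h := strictConcaveOn_log_Ioi.neg.secant_strict_mono (a := 1) (x := 1 - y / l)
    (y := 1 - x / l) (mem_Ioi.2 one_pos) (sub_pos.2 hyl) (sub_pos.2 hxl) (by linarith) (by linarith)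
    (by linarith)
  have e : ∀ t, 0 < t → -Real.log (1 - t / l) / (q * t) =
      -(((-Real.log) (1 - t / l) - (-Real.log) 1) / (1 - t / l - 1)) / (q * l) := by
    intro t ht
    simp only [Pi.neg_apply, Real.log_one]
    generalize Real.log (1 - t / l) = r
    rw [show 1 - t / l - 1 = -(t / l) by ring]
    field_simp
    simp
  dsimp only
  rw [e x hx.1, e y hy.1]
  gcongr

/-- In units of `1 / pH`, the average waiting time of `H` agents converges as `pH → 0`. -/
lemma tendsto_mul_averageWaitH {lamH lamE pE : ℝ} (hH : lamH ∈ Ioo 0 lamE)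
    (hpE : pE ∈ Ioc (0 : ℝ) 1) {π : ℝ → PMF State}
    (hπ : ∀ pH ∈ Ioc (0 : ℝ) 1, IsSteadyState ⟨lamH, lamE, pH, pE⟩ .H (π pH)) :
    Tendsto (fun pH : ℝ => pH * (averageWaitH ⟨lamH, lamE, pH, pE⟩ .H (π pH)).toReal) (𝓝[>] 0)
      (𝓝 (-Real.log (1 - lamH / lamE) / (pE * lamH))) := by
  have hlE : 0 < lamE := hH.1.trans hH.2
  have hsmall : ∀ᶠ p : ℝ in 𝓝[>] 0, p ∈ Ioo (0 : ℝ) 1 := Ioo_mem_nhdsGT one_pos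
  have hreg : ∀ p ∈ Ioo (0 : ℝ) 1, Market.Regular ⟨lamH, lamE, p, pE⟩ := fun p hp =>
    regular_mk hH.1 hlE ⟨hp.1, hp.2.le⟩ hpE
  have hbal : ∀ p ∈ Ioo (0 : ℝ) 1, Market.Balanced ⟨lamH, lamE, p, pE⟩ := fun p hp =>
    ⟨hreg p hp, hH.2, sub_pos.2 (mul_lt_one_of_nonneg_of_lt_one_right hpE.2 hp.1.le hp.2)⟩
  set X : ℝ := -Real.log (1 - lamH / lamE) with hX
  set a : ℝ → ℝ := fun p => -Real.log (1 - pE * p) with ha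
  -- The value pH = 1 is arbitrary: `lyapunovBound` is the same for all pH.
  set C : ℝ := Market.lyapunovBound ⟨lamH, lamE, 1, pE⟩ with hC
  have hderiv : HasDerivAt a pE 0 := by
    have h1 : HasDerivAt (fun p : ℝ => 1 - pE * p) (-pE) 0 := by
      simpa using ((hasDerivAt_id (0 : ℝ)).const_mul pE).const_sub 1
    have h2 := (h1.log (by simp)).neg
    rw [mul_zero, sub_zero, div_one, neg_neg] at h2
    exact h2
  have ha0 : Tendsto a (𝓝[>] 0) (𝓝 0) := by
    have h1 := hderiv.continuousAt.tendsto.mono_left (nhdsWithin_le_nhds (s := Ioi (0 : ℝ)))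
    simpa [ha] using h1
  -- This is the inverse difference quotient at 0 of a, the decay as a function of pH, whose
  -- derivative there is pE.
  have hslope : Tendsto (fun p => p / a p) (𝓝[>] 0) (𝓝 pE⁻¹) := by
    have h1 := hderiv.tendsto_slope.mono_left
      (nhdsWithin_mono 0 (fun x (hx : 0 < x) => hx.ne') : 𝓝[>] (0 : ℝ) ≤ 𝓝[≠] 0)
    refine (h1.inv₀ hpE.1.ne').congr fun p => ?_
    simp [slope_def_field, ha]
  have hmean : Tendsto (fun p => a p * (meanH (π p)).toReal) (𝓝[>] 0) (𝓝 X) := by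
    rw [Metric.tendsto_nhds]
    intro ε hε
    obtain ⟨M, hM0, hM⟩ := exists_abs_sub_le X (half_pos hε)
    have h1 : Tendsto (fun p => M * a p / (2 * lamE) * C) (𝓝[>] 0) (𝓝 0) := by
      simpa using ((ha0.const_mul M).div_const (2 * lamE)).mul_const C
    filter_upwards [hsmall, h1.eventually_lt_const (half_pos hε)] with p hp hp1
    have h2 := (hbal p hp).abs_decay_mul_meanH_sub_le (hπ p ⟨hp.1, hp.2.le⟩) (half_pos hε).le hM0 hM
    have h3 : |a p * (meanH (π p)).toReal - X| ≤ ε / 2 + M * a p / (2 * lamE) * C := h2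
    rw [Real.dist_eq]
    linarith
  have hlim := (hslope.mul hmean).div_const lamH
  rw [show pE⁻¹ * X / lamH = X / (pE * lamH) by field_simp] at hlim
  refine hlim.congr' ?_
  filter_upwards [hsmall] with p hp
  have hap : a p ≠ 0 := (hbal p hp).decay_pos.ne'
  rw [(hreg p hp).toReal_averageWaitH hH.2 (hπ p ⟨hp.1, hp.2.le⟩)]
  field_simp

end DynMarket

theorem mainTheorem8 (lamE pE : ℝ) (hlamE : 0 < lamE) (hpE0 : 0 < pE) (hpE1 : pE ≤ 1) :
    (∀ lamH ∈ Ioo 0 lamE, ∀ pH ∈ Ioc (0 : ℝ) 1,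
      ∃! π : PMF DynMarket.State, DynMarket.IsSteadyState ⟨lamH, lamE, pH, pE⟩ .H π) ∧
    ∃ L : ℝ → ℝ, StrictMonoOn L (Ioo 0 lamE) ∧
      ∀ lamH ∈ Ioo 0 lamE, ∀ π : ℝ → PMF DynMarket.State,
        (∀ pH ∈ Ioc (0 : ℝ) 1, DynMarket.IsSteadyState ⟨lamH, lamE, pH, pE⟩ .H (π pH)) →
          (∀ pH ∈ Ioc (0 : ℝ) 1,
            DynMarket.averageWaitH ⟨lamH, lamE, pH, pE⟩ .H (π pH) ≠ ⊤) ∧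
          Tendsto
            (fun pH : ℝ => pH * (DynMarket.averageWaitH ⟨lamH, lamE, pH, pE⟩ .H (π pH)).toReal)
            (𝓝[>] 0) (𝓝 (L lamH)) := by
  have hreg : ∀ lamH ∈ Ioo 0 lamE, ∀ pH ∈ Ioc (0 : ℝ) 1,
      DynMarket.Market.Regular ⟨lamH, lamE, pH, pE⟩ := fun lamH hH pH hp =>
    DynMarket.regular_mk hH.1 hlamE hp ⟨hpE0, hpE1⟩
  refine ⟨fun lamH hH pH hp => (hreg lamH hH pH hp).existsUnique_steadyState hH.2,
    fun x => -Real.log (1 - x / lamE) / (pE * x),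
    DynMarket.strictMonoOn_neg_log_one_sub_div hlamE hpE0, fun lamH hH π hπ => ⟨?_, ?_⟩⟩
  · exact fun pH hp => (hreg lamH hH pH hp).averageWaitH_ne_top hH.2 (hπ pH hp)
  · exact DynMarket.tendsto_mul_averageWaitH hH ⟨hpE0, hpE1⟩ hπ
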